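/- Let $a>0$, $b<0$, let $\varepsilon, d_1,d_2,d_4,d_5,d_6\in\mathbb R$, and consider the planar system $$\dot x=y,\qquad \dot y=-x-\frac{2b}{a^2}x^3+\varepsilon\,(d_3+d_2x^2+d_1x^4+d_4y^2+d_5x^6+d_6y^4)\,y,\qquad d_3=0 .$$ In polar coordinates $x=r\cos\theta$, $y=r\sin\theta$, let $r(\theta,\rho)$ be the solution of the equation $\frac{dr}{d\theta}=\dot r/\dot\theta$ with $r(0,\rho)=\rho$. For all sufficiently small $\rho$ it exists and is unique on $0\le\theta\le 2\pi$, and the return map $\Pi(\rho)=r(2\pi,\rho)$ is analytic at $\rho=0$. Let $V_k$, the $k$-th Lyapunov constant, be the coefficient of $\rho^k$ in the Taylor series of $\Pi$ at $0$. Then: 1. $V_1=1$ and $V_3=-\frac14\pi\varepsilon(d_2+3d_4)$. 2. If $V_3=0$, then $V_5=-\dfrac{\pi\varepsilon\,(a^2d_1+5a^2d_6+6bd_4)}{8a^2}$. 3. If $V_3=V_5=0$, then $V_7=-\dfrac{\pi\varepsilon\,(-6a^2d_4^3\varepsilon^2+5a^2d_5+80bd_6)}{64a^2}$. 4. If $V_3=V_5=V_7=0$,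 then $V_9=\dfrac{3\pi\varepsilon\,(15a^4d_4^2d_6\varepsilon^2+12a^2bd_4^3\varepsilon^2-35b^2d_6)}{160a^4}$. 5. If $V_3=V_5=V_7=V_9=0$, then $3a^4d_4^2\varepsilon^2-7b^2\neq0$ and $$V_{11}=-\frac{3\pi d_4^3\varepsilon^3}{3200a^4(3a^4d_4^2\varepsilon^2-7b^2)^2}\left(315a^{12}d_4^6\varepsilon^6+2644a^8b^2d_4^4\varepsilon^4-9065a^4b^4d_4^2\varepsilon^2-7350b^6\right).$$ 6. For every $M$ there is $\varepsilon_0>0$, depending only on $a$, $b$ and $M$, such that whenever $0<|\varepsilon|<\varepsilon_0$, $|d_4|\le M$ and $V_3=V_5=V_7=V_9=0$, one has $V_{11}=0$ if and only if $d_4=0$. 7. If $\varepsilon\ne0$, $V_3=V_5=V_7=V_9=0$ and $d_4=0$, then $d_1=d_2=d_5=d_6=0$, the system is Hamiltonian, and the origin is a centre (it has arbitrarily small neighbourhoods which, apart from the origin, are filled with nonconstant periodic orbits). -/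

import Mathlib

open Set Filter Topology

/-- The coefficients `d₁, …, d₆` of the perturbation. -/
structure RLCoeffs where
  d₁ : ℝ
  d₂ : ℝ
  d₃ : ℝ
  d₄ : ℝ
  d₅ : ℝ
  d₆ : ℝ

/-- The vector field of the canonical form (for `a > 0`, `b < 0`)
`ẋ = y`, `ẏ = -x - (2 b / a²) x³ + ε (d₃ + d₂ x² + d₁ x⁴ + d₄ y² + d₅ x⁶ + d₆ y⁴) y`. -/
noncomputable def canonicalField (a b ε : ℝ) (d : RLCoeffs) (p : ℝ × ℝ) : ℝ × ℝ :=
  (p.2,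
    -p.1 - 2 * b / a ^ 2 * p.1 ^ 3
      + ε * ((d.d₃ + d.d₂ * p.1 ^ 2 + d.d₁ * p.1 ^ 4 + d.d₄ * p.2 ^ 2
              + d.d₅ * p.1 ^ 6 + d.d₆ * p.2 ^ 4) * p.2))

/-- For the planar system `(ẋ, ẏ) = F (x, y)` and `x = r cos θ`, `y = r sin θ`: the radial speed
`ṙ = ẋ cos θ + ẏ sin θ`. -/
noncomputable def radialSpeed (F : ℝ × ℝ → ℝ × ℝ) (θ r : ℝ) : ℝ :=
  (F (r * Real.cos θ, r * Real.sin θ)).1 * Real.cos θ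
    + (F (r * Real.cos θ, r * Real.sin θ)).2 * Real.sin θ

/-- The transverse speed `r θ̇ = ẏ cos θ - ẋ sin θ`. -/
noncomputable def transverseSpeed (F : ℝ × ℝ → ℝ × ℝ) (θ r : ℝ) : ℝ :=
  (F (r * Real.cos θ, r * Real.sin θ)).2 * Real.cos θ
    - (F (r * Real.cos θ, r * Real.sin θ)).1 * Real.sin θ

/-- `r` solves the polar equation `dr/dθ = ṙ / θ̇ = r ṙ / (r θ̇)` on `0 ≤ θ ≤ 2π` with `r(0) = ρ`.
The equation is only meaningful where `θ̇ ≠ 0`, which is required along the solution; at `r = 0`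
(the equilibrium) the right-hand side takes its limit value `0`. -/
def IsPolarSolution (F : ℝ × ℝ → ℝ × ℝ) (ρ : ℝ) (r : ℝ → ℝ) : Prop :=
  r 0 = ρ ∧
  ∀ θ ∈ Icc 0 (2 * Real.pi),
    (r θ ≠ 0 → transverseSpeed F θ (r θ) ≠ 0) ∧
    HasDerivWithinAt r (r θ * radialSpeed F θ (r θ) / transverseSpeed F θ (r θ))
      (Icc 0 (2 * Real.pi)) θ

/-- For every small `ρ`, the polar equation has a solution on `[0, 2π]` with `r(0) = ρ`, and it is
unique. -/
def PolarWellPosed (F : ℝ × ℝ → ℝ × ℝ) : Prop :=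
  ∀ᶠ ρ in 𝓝 (0 : ℝ), ∃ r, IsPolarSolution F ρ r ∧
    ∀ r', IsPolarSolution F ρ r' → EqOn r' r (Icc 0 (2 * Real.pi))

open Classical in
/-- The Poincaré return map `Π(ρ) = r(2π, ρ)`, where `r(·, ρ)` is the solution of the polar equation
with `r(0, ρ) = ρ` (and `0` where there is none). -/
noncomputable def returnMap (F : ℝ × ℝ → ℝ × ℝ) (ρ : ℝ) : ℝ :=
  if h : ∃ r, IsPolarSolution F ρ r then h.choose (2 * Real.pi) else 0

/-- The `k`-th Lyapunov constant: the coefficient of `ρ ^ k` in the power series at `0` of the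
return map. -/
noncomputable def lyapunovConstant (F : ℝ × ℝ → ℝ × ℝ) (k : ℕ) : ℝ :=
  iteratedDeriv k (returnMap F) 0 / (k.factorial : ℝ)

/-- The planar system is Hamiltonian: `ẋ = ∂H/∂y`, `ẏ = -∂H/∂x` for a smooth function `H`. -/
def IsHamiltonianField (F : ℝ × ℝ → ℝ × ℝ) : Prop :=
  ∃ H : ℝ × ℝ → ℝ, ContDiff ℝ (⊤ : ℕ∞) H ∧
    ∀ p, F p = (fderiv ℝ H p (0, 1), -fderiv ℝ H p (1, 0))

/-- The equilibrium `p` is a centre: it has arbitrarily small neighbourhoods `U` such that `U \ {p}`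
is filled with nonconstant periodic orbits. -/
def IsCentre (F : ℝ × ℝ → ℝ × ℝ) (p : ℝ × ℝ) : Prop :=
  F p = 0 ∧
  ∀ W ∈ 𝓝 p, ∃ U ∈ 𝓝 p, U ⊆ W ∧
    ∀ q ∈ U, q ≠ p →
      ∃ (γ : ℝ → ℝ × ℝ) (T : ℝ), 0 < T ∧ γ 0 = q ∧
        (∀ t, HasDerivAt γ (F (γ t)) t) ∧
        (∀ t, γ (t + T) = γ t) ∧
        (∃ t, γ t ≠ q) ∧
        (∀ t, γ t ∈ U ∧ γ t ≠ p)

/-! The linear part is a clockwise rotation and the nonlinear part is a sum of forms of degrees 3,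
5, 7 in the second component. The polar equation is therefore regular near `r = 0`, with right-hand
side of order `r³`. As a fixed-point equation in the Banach algebra `C([0, 2π])` it is solved by the
analytic inverse function theorem, and a linear bound on the difference of two solutions gives
uniqueness. So the return map is the end value of an analytic family
(`exists_isPolarFamily_returnMap`).

The constants come from Lyapunov's method. Let `K = (x² + y²)/2 + …` be a polynomial with `K(x, 0) =
x²/2` whose derivative along the field starts in degree `m + 1`. Integrating along one turn gives
`(Π(ρ)² - ρ²)/2 = -ρ^(m+1) Z(ρ)` with `Z` analytic. As `Π(ρ) + ρ ~ 2ρ`, the coefficient of `ρ^m` is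
`-Z(0)`, minus the circle integral of the leading form (`lyapunovConstant_eq_neg_integral`).

Extending `K` by one form means inverting `y ∂x - x ∂y`, possible exactly when the leading form has
mean zero on the circle, that is, when the current Lyapunov constant vanishes. The conditions
determine `e₂`, `e₁`, `e₅`, and then `e₆`, in terms of `e₄ = ε d₄` and `k = 2b/a²`. In `V₁₁` there
remains `e₄³` times a factor that is negative when `e₄` is small against `k`. If `e₄ = 0`,
everything collapses to the Duffing oscillator, whose small orbits are parametrized explicitly. -/

/-! ### The polar equation and uniqueness of its solutions. -/

/-- The even polynomial `φ₀ + φ₁ r² + φ₂ r⁴`. -/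
def evenPoly {A : Type*} [CommRing A] (φ : Fin 3 → A) (r : A) : A :=
  φ 0 + φ 1 * r ^ 2 + φ 2 * r ^ 4

/-- The right-hand side of the polar equation of the system
`ẋ = y`, `ẏ = -x + r³ (φ₀(θ) + φ₁(θ) r² + φ₂(θ) r⁴)`. -/
noncomputable def polarRhs (φ : Fin 3 → C(ℝ, ℝ)) (θ r : ℝ) : ℝ :=
  -(r ^ 3 * Real.sin θ * evenPoly (fun i => φ i θ) r) /
    (1 - r ^ 2 * Real.cos θ * evenPoly (fun i => φ i θ) r)

/-- `r` solves the polar equation on `[0, T]`, the angular speed being nonzero along it. -/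
def IsPolarOrbit (φ : Fin 3 → C(ℝ, ℝ)) (T : ℝ) (r : ℝ → ℝ) : Prop :=
  ∀ θ ∈ Icc 0 T, 1 - r θ ^ 2 * Real.cos θ * evenPoly (fun i => φ i θ) (r θ) ≠ 0 ∧
    HasDerivWithinAt r (polarRhs φ θ (r θ)) (Icc 0 T) θ

/-- Two solutions of the polar equation with the same initial value agree. -/
theorem IsPolarOrbit.eqOn {φ : Fin 3 → C(ℝ, ℝ)} {T : ℝ} {r₁ r₂ : ℝ → ℝ}
    (h₁ : IsPolarOrbit φ T r₁) (h₂ : IsPolarOrbit φ T r₂) (h0 : r₁ 0 = r₂ 0) :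
    EqOn r₁ r₂ (Icc 0 T) := by
  have c₁ : ContinuousOn r₁ (Icc 0 T) := fun θ hθ => (h₁ θ hθ).2.continuousWithinAt
  have c₂ : ContinuousOn r₂ (Icc 0 T) := fun θ hθ => (h₂ θ hθ).2.continuousWithinAt
  -- The difference quotient of the right-hand side between the two solutions, with the factor `r₁ -
  -- r₂` divided out algebraically. It is continuous on a compact interval, so its bound serves as
  -- the Lipschitz constant for Grönwall.
  set g : ℝ → ℝ := fun θ =>
    -(Real.sin θ * (φ 0 θ * (r₁ θ ^ 2 + r₁ θ * r₂ θ + r₂ θ ^ 2)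
        + φ 1 θ * (r₁ θ ^ 4 + r₁ θ ^ 3 * r₂ θ + r₁ θ ^ 2 * r₂ θ ^ 2 + r₁ θ * r₂ θ ^ 3 + r₂ θ ^ 4)
        + φ 2 θ * (r₁ θ ^ 6 + r₁ θ ^ 5 * r₂ θ + r₁ θ ^ 4 * r₂ θ ^ 2 + r₁ θ ^ 3 * r₂ θ ^ 3
            + r₁ θ ^ 2 * r₂ θ ^ 4 + r₁ θ * r₂ θ ^ 5 + r₂ θ ^ 6)
        - Real.cos θ * (r₁ θ ^ 2 * r₂ θ ^ 2 * evenPoly (fun i => φ i θ) (r₁ θ)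
            * evenPoly (fun i => φ i θ) (r₂ θ)))) /
      ((1 - r₁ θ ^ 2 * Real.cos θ * evenPoly (fun i => φ i θ) (r₁ θ))
        * (1 - r₂ θ ^ 2 * Real.cos θ * evenPoly (fun i => φ i θ) (r₂ θ))) with hg
  have hcg : ContinuousOn g (Icc 0 T) := by
    refine ContinuousOn.div ?_ ?_ fun θ hθ => mul_ne_zero (h₁ θ hθ).1 (h₂ θ hθ).1
    all_goals
      simp only [evenPoly]
      fun_prop
  obtain ⟨K, hK⟩ := isCompact_Icc.exists_bound_of_continuousOn hcg
  have key := eq_zero_of_abs_deriv_le_mul_abs_self_of_eq_zero_right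
    (f := fun θ => r₁ θ - r₂ θ)
    (f' := fun θ => polarRhs φ θ (r₁ θ) - polarRhs φ θ (r₂ θ)) (K := K) (a := 0) (b := T)
    (c₁.sub c₂) ?_ (by simp [h0]) ?_
  · intro θ hθ
    exact sub_eq_zero.1 (key θ hθ)
  · intro θ hθ
    have hθ' : θ ∈ Icc 0 T := Ico_subset_Icc_self hθ
    refine HasDerivWithinAt.mono_of_mem_nhdsWithin ((h₁ θ hθ').2.sub (h₂ θ hθ').2) ?_
    exact Icc_mem_nhdsGE_of_mem hθ
  · intro θ hθ
    have hθ' : θ ∈ Icc 0 T := Ico_subset_Icc_self hθ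
    have : polarRhs φ θ (r₁ θ) - polarRhs φ θ (r₂ θ) = g θ * (r₁ θ - r₂ θ) := by
      have d₁ := (h₁ θ hθ').1
      have d₂ := (h₂ θ hθ').1
      simp only [hg, polarRhs]
      rw [div_sub_div _ _ d₁ d₂, div_mul_eq_mul_div]
      congr 1
      simp only [evenPoly]
      ring
    rw [this, norm_mul]
    exact mul_le_mul_of_nonneg_right (hK θ hθ') (norm_nonneg _)

/-! ### Analytic dependence on the initial value, in the Banach algebra `C([0, T])`. -/

section VolterraOperator

variable {T : ℝ} (hT : 0 ≤ T)

/-- The operator `g ↦ (θ ↦ ∫₀^θ g)` on the continuous functions on `[0, T]`. -/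
noncomputable def primitiveCLM : C(Icc (0 : ℝ) T, ℝ) →L[ℝ] C(Icc (0 : ℝ) T, ℝ) :=
  LinearMap.mkContinuous
    { toFun := fun g => ⟨fun θ => ∫ t in (0 : ℝ)..θ, IccExtend hT g t, by
        have : Continuous (IccExtend hT g) := g.continuous.Icc_extend'
        exact (intervalIntegral.continuous_primitive
          (fun a b => this.intervalIntegrable a b) 0).comp continuous_subtype_val⟩
      map_add' := fun f g => by
        ext θ
        have hf : Continuous (IccExtend hT f) := f.continuous.Icc_extend'
        have hg : Continuous (IccExtend hT g) := g.continuous.Icc_extend'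
        exact intervalIntegral.integral_add (hf.intervalIntegrable _ _) (hg.intervalIntegrable _ _)
      map_smul' := fun c g => by
        ext θ
        exact intervalIntegral.integral_smul c _ }
    T fun g => by
      refine (ContinuousMap.norm_le _ (by positivity)).2 fun θ => ?_
      have h := intervalIntegral.norm_integral_le_of_norm_le_const (a := 0) (b := θ)
        (f := IccExtend hT g) (C := ‖g‖) fun t _ => g.norm_coe_le_norm _
      refine h.trans ?_
      rw [sub_zero, abs_of_nonneg θ.2.1, mul_comm]
      exact mul_le_mul_of_nonneg_right θ.2.2 (norm_nonneg _)

theorem primitiveCLM_apply (g : C(Icc (0 : ℝ) T, ℝ)) (θ : Icc (0 : ℝ) T) :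
    primitiveCLM hT g θ = ∫ t in (0 : ℝ)..θ, IccExtend hT g t := rfl

theorem hasDerivWithinAt_primitiveCLM (g : C(Icc (0 : ℝ) T, ℝ)) (θ : Icc (0 : ℝ) T) :
    HasDerivWithinAt (IccExtend hT (primitiveCLM hT g)) (g θ) (Icc 0 T) θ := by
  have hg : Continuous (IccExtend hT g) := g.continuous.Icc_extend'
  have h := intervalIntegral.integral_hasDerivAt_right (hg.intervalIntegrable 0 θ)
    (hg.stronglyMeasurableAtFilter _ _) hg.continuousAt
  rw [IccExtend_val] at h
  refine h.hasDerivWithinAt.congr (fun t ht => ?_) ?_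
  · rw [IccExtend_of_mem hT _ ht, primitiveCLM_apply]
  · rw [IccExtend_val, primitiveCLM_apply]

end VolterraOperator

/-- An analytic map whose derivative is the identity has an analytic local right inverse. -/
theorem AnalyticAt.exists_analyticAt_rightInverse {E : Type*} [NormedAddCommGroup E]
    [NormedSpace ℝ E] [CompleteSpace E] {G : E → E} (hG : AnalyticAt ℝ G 0) (hG0 : G 0 = 0)
    (hG' : HasFDerivAt G (ContinuousLinearMap.id ℝ E) 0) :
    ∃ S : E → E, AnalyticAt ℝ S 0 ∧ S 0 = 0 ∧ HasFDerivAt S (ContinuousLinearMap.id ℝ E) 0 ∧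
      ∀ᶠ y in 𝓝 0, G (S y) = y := by
  have hs : HasStrictFDerivAt G ((ContinuousLinearEquiv.refl ℝ E : E ≃L[ℝ] E) : E →L[ℝ] E) 0 := by
    have := hG.hasStrictFDerivAt
    rwa [hG'.fderiv] at this
  refine ⟨(hs.toOpenPartialHomeomorph G).symm, ?_, ?_, ?_, ?_⟩
  · have := OpenPartialHomeomorph.analyticAt_symm' (hs.toOpenPartialHomeomorph G)
      (i := ContinuousLinearEquiv.refl ℝ E) hs.mem_toOpenPartialHomeomorph_source
      (by simpa using hG) (by simpa using hG'.fderiv)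
    simpa [hG0] using this
  · have := (hs.toOpenPartialHomeomorph G).left_inv hs.mem_toOpenPartialHomeomorph_source
    simpa [hG0] using this
  · have := hs.to_localInverse.hasFDerivAt
    rw [hG0] at this
    exact this
  · have := hs.eventually_right_inverse
    rwa [hG0] at this

section PolarFamily

variable (φ : Fin 3 → C(ℝ, ℝ)) (T : ℝ)

/-- The sine on `[0, T]`, as an element of the Banach algebra of continuous functions. -/
noncomputable def sinOn : C(Icc (0 : ℝ) T, ℝ) := ⟨fun θ => Real.sin θ, by fun_prop⟩

/-- The cosine on `[0, T]`, as an element of the Banach algebra of continuous functions. -/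
noncomputable def cosOn : C(Icc (0 : ℝ) T, ℝ) := ⟨fun θ => Real.cos θ, by fun_prop⟩

/-- The polynomial `evenPoly` with coefficients in the Banach algebra `C([0, T])`. -/
noncomputable def evenPolyOn (r : C(Icc (0 : ℝ) T, ℝ)) : C(Icc (0 : ℝ) T, ℝ) :=
  evenPoly (fun i => (φ i).restrict (Icc 0 T)) r

theorem evenPolyOn_apply (r : C(Icc (0 : ℝ) T, ℝ)) (θ : Icc (0 : ℝ) T) :
    evenPolyOn φ T r θ = evenPoly (fun i => φ i θ) (r θ) := by
  simp [evenPolyOn, evenPoly]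

/-- The denominator of the polar equation, on `C([0, T])`. -/
noncomputable def polarDenOn (r : C(Icc (0 : ℝ) T, ℝ)) : C(Icc (0 : ℝ) T, ℝ) :=
  1 - r ^ 2 * cosOn T * evenPolyOn φ T r

theorem polarDenOn_apply (r : C(Icc (0 : ℝ) T, ℝ)) (θ : Icc (0 : ℝ) T) :
    polarDenOn φ T r θ = 1 - r θ ^ 2 * Real.cos θ * evenPoly (fun i => φ i θ) (r θ) := by
  simp [polarDenOn, evenPolyOn_apply, cosOn]

theorem polarDenOn_zero : polarDenOn φ T 0 = 1 := by simp [polarDenOn]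

theorem analyticAt_evenPolyOn (r : C(Icc (0 : ℝ) T, ℝ)) :
    AnalyticAt ℝ (evenPolyOn φ T) r := by
  unfold evenPolyOn evenPoly
  fun_prop

theorem analyticAt_polarDenOn (r : C(Icc (0 : ℝ) T, ℝ)) :
    AnalyticAt ℝ (polarDenOn φ T) r := by
  have := analyticAt_evenPolyOn φ T r
  unfold polarDenOn
  fun_prop

/-- The inverse of the denominator. -/
noncomputable def polarInvDenOn (r : C(Icc (0 : ℝ) T, ℝ)) : C(Icc (0 : ℝ) T, ℝ) :=
  Ring.inverse (polarDenOn φ T r)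

theorem polarInvDenOn_zero : polarInvDenOn φ T 0 = 1 := by
  simp [polarInvDenOn, polarDenOn_zero]

theorem analyticAt_polarInvDenOn : AnalyticAt ℝ (polarInvDenOn φ T) 0 := by
  have h : AnalyticAt ℝ Ring.inverse (polarDenOn φ T 0) := by
    rw [polarDenOn_zero]
    exact analyticAt_inverse (𝕜 := ℝ) (1 : C(Icc (0 : ℝ) T, ℝ)ˣ)
  exact h.comp (analyticAt_polarDenOn φ T 0)

theorem polarDenOn_ne_zero {r : C(Icc (0 : ℝ) T, ℝ)} (h : IsUnit (polarDenOn φ T r))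
    (θ : Icc (0 : ℝ) T) : polarDenOn φ T r θ ≠ 0 := by
  intro h0
  obtain ⟨u, hu⟩ := h
  have := congrArg (fun f : C(Icc (0 : ℝ) T, ℝ) => f θ) u.mul_inv
  rw [hu] at this
  simp [h0] at this

theorem polarInvDenOn_apply {r : C(Icc (0 : ℝ) T, ℝ)} (h : IsUnit (polarDenOn φ T r))
    (θ : Icc (0 : ℝ) T) : polarInvDenOn φ T r θ = (polarDenOn φ T r θ)⁻¹ := by
  have := congrArg (fun f : C(Icc (0 : ℝ) T, ℝ) => f θ) (Ring.mul_inverse_cancel _ h)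
  exact eq_inv_of_mul_eq_one_right this

/-- The right-hand side of the polar equation on `C([0, T])`. -/
noncomputable def polarRhsOn (r : C(Icc (0 : ℝ) T, ℝ)) : C(Icc (0 : ℝ) T, ℝ) :=
  -(r ^ 3 * sinOn T * evenPolyOn φ T r) * polarInvDenOn φ T r

theorem polarRhsOn_apply {r : C(Icc (0 : ℝ) T, ℝ)} (h : IsUnit (polarDenOn φ T r))
    (θ : Icc (0 : ℝ) T) : polarRhsOn φ T r θ = polarRhs φ θ (r θ) := by
  have : polarRhsOn φ T r θ
      = -(r θ ^ 3 * Real.sin θ * evenPolyOn φ T r θ) * polarInvDenOn φ T r θ := rfl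
  rw [this, polarInvDenOn_apply φ T h, evenPolyOn_apply, polarDenOn_apply, polarRhs, div_eq_mul_inv]

theorem analyticAt_polarRhsOn : AnalyticAt ℝ (polarRhsOn φ T) 0 := by
  have h₁ := analyticAt_evenPolyOn φ T 0
  have h₂ := analyticAt_polarInvDenOn φ T
  unfold polarRhsOn
  fun_prop

/-- The map is `r · r ·` (analytic), and a double zero has zero derivative. This is what makes the
linearization of the integral equation the identity. -/
theorem hasFDerivAt_polarRhsOn :
    HasFDerivAt (polarRhsOn φ T)
      (0 : C(Icc (0 : ℝ) T, ℝ) →L[ℝ] C(Icc (0 : ℝ) T, ℝ)) 0 := by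
  have h₁ := analyticAt_evenPolyOn φ T 0
  have h₂ := analyticAt_polarInvDenOn φ T
  have h : AnalyticAt ℝ (fun r : C(Icc (0 : ℝ) T, ℝ) =>
      r * (-(sinOn T * evenPolyOn φ T r) * polarInvDenOn φ T r)) 0 := by fun_prop
  have hd := (hasFDerivAt_id (𝕜 := ℝ) (0 : C(Icc (0 : ℝ) T, ℝ))).mul
    ((hasFDerivAt_id (𝕜 := ℝ) (0 : C(Icc (0 : ℝ) T, ℝ))).mul h.differentiableAt.hasFDerivAt)
  refine (hd.congr_fderiv ?_).congr_of_eventuallyEq (Eventually.of_forall fun r => ?_)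
  · simp
  · simp only [polarRhsOn, Pi.mul_apply, id_eq]
    ring

variable {T}

/-- The polar equation has a family of solutions on `[0, T]` which depends analytically on the
initial value. -/
theorem exists_analytic_polarFamily (hT : 0 ≤ T) :
    ∃ R : ℝ → C(Icc (0 : ℝ) T, ℝ), AnalyticAt ℝ R 0 ∧ R 0 = 0 ∧ HasDerivAt R 1 0 ∧
      ∀ᶠ ρ in 𝓝 0, IsUnit (polarDenOn φ T (R ρ)) ∧
        R ρ = algebraMap ℝ _ ρ + primitiveCLM hT (polarRhsOn φ T (R ρ)) := by
  -- The integral equation reads `G r = ρ` with `ρ` a constant function. The family is a local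
  -- inverse of `G` restricted to the line of constants.
  set G : C(Icc (0 : ℝ) T, ℝ) → C(Icc (0 : ℝ) T, ℝ) :=
    fun r => r - primitiveCLM hT (polarRhsOn φ T r) with hG
  have hr0 : polarRhsOn φ T 0 = 0 := by simp [polarRhsOn]
  have hGa : AnalyticAt ℝ G 0 :=
    analyticAt_id.sub ((primitiveCLM hT).analyticAt _ |>.comp (analyticAt_polarRhsOn φ T))
  have hG' : HasFDerivAt G (ContinuousLinearMap.id ℝ _) 0 := by
    have := (hasFDerivAt_id (𝕜 := ℝ) (0 : C(Icc (0 : ℝ) T, ℝ))).sub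
      ((primitiveCLM hT).hasFDerivAt.comp _ (hasFDerivAt_polarRhsOn φ T))
    refine this.congr_fderiv ?_
    simp
  obtain ⟨S, hSa, hS0, hS', hSG⟩ := hGa.exists_analyticAt_rightInverse (by simp [hG, hr0]) hG'
  have hlin : AnalyticAt ℝ (algebraMap ℝ C(Icc (0 : ℝ) T, ℝ)) 0 :=
    (Algebra.linearMap ℝ C(Icc (0 : ℝ) T, ℝ)).toContinuousLinearMap.analyticAt 0
  have hlin0 : Tendsto (algebraMap ℝ C(Icc (0 : ℝ) T, ℝ)) (𝓝 0) (𝓝 0) := by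
    simpa using hlin.continuousAt.tendsto
  have hRa : AnalyticAt ℝ (fun ρ => S (algebraMap ℝ C(Icc (0 : ℝ) T, ℝ) ρ)) 0 :=
    AnalyticAt.fun_comp (by simpa using hSa) hlin
  have hR0 : S (algebraMap ℝ C(Icc (0 : ℝ) T, ℝ) 0) = 0 := by simpa using hS0
  refine ⟨_, hRa, hR0, ?_, ?_⟩
  · have h1 : HasDerivAt (algebraMap ℝ C(Icc (0 : ℝ) T, ℝ)) 1 0 := by
      have := (Algebra.linearMap ℝ C(Icc (0 : ℝ) T, ℝ)).toContinuousLinearMap.hasDerivAt (x := 0)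
      have h1 : (Algebra.linearMap ℝ C(Icc (0 : ℝ) T, ℝ)).toContinuousLinearMap 1 = 1 := by simp
      rw [h1] at this
      exact this
    have h2 : HasFDerivAt S (ContinuousLinearMap.id ℝ _)
        (algebraMap ℝ C(Icc (0 : ℝ) T, ℝ) 0) := by simpa using hS'
    exact h2.comp_hasDerivAt _ h1
  -- The denominator is `1` at `ρ = 0` and units form an open set, so the formal inverse stays a
  -- pointwise one for small `ρ`.
  · have hden : ∀ᶠ ρ : ℝ in 𝓝 0,
        IsUnit (polarDenOn φ T (S (algebraMap ℝ C(Icc (0 : ℝ) T, ℝ) ρ))) := by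
      have hc : ContinuousAt (fun ρ => polarDenOn φ T (S (algebraMap ℝ C(Icc (0 : ℝ) T, ℝ) ρ))) 0 :=
        ((analyticAt_polarDenOn φ T _).comp hRa).continuousAt
      refine hc.eventually_mem (Units.isOpen.mem_nhds ?_)
      simp only [hR0, polarDenOn_zero]
      exact isUnit_one
    filter_upwards [hden, hlin0.eventually hSG] with ρ h1 h2
    refine ⟨h1, ?_⟩
    rw [hG] at h2
    exact eq_add_of_sub_eq h2

/-- A fixed point in `C([0, T])` solves the polar equation. -/
theorem isPolarOrbit_of_fixedPoint (hT : 0 ≤ T) {r : C(Icc (0 : ℝ) T, ℝ)} {ρ : ℝ}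
    (hu : IsUnit (polarDenOn φ T r))
    (hr : r = algebraMap ℝ _ ρ + primitiveCLM hT (polarRhsOn φ T r)) :
    IsPolarOrbit φ T (IccExtend hT r) ∧ IccExtend hT r 0 = ρ := by
  constructor
  · intro θ hθ
    rw [IccExtend_of_mem hT _ hθ]
    refine ⟨?_, ?_⟩
    · have := polarDenOn_ne_zero φ T hu ⟨θ, hθ⟩
      rwa [polarDenOn_apply] at this
    · have h := (hasDerivWithinAt_primitiveCLM hT (polarRhsOn φ T r) ⟨θ, hθ⟩).const_add ρ
      rw [polarRhsOn_apply φ T hu] at h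
      refine h.congr_of_mem (fun t ht => ?_) hθ
      rw [IccExtend_of_mem hT _ ht, IccExtend_of_mem hT _ ht]
      exact congrArg (fun f : C(Icc (0 : ℝ) T, ℝ) => f ⟨t, ht⟩) hr
  · have h0 : (0 : ℝ) ∈ Icc 0 T := ⟨le_rfl, hT⟩
    rw [IccExtend_of_mem hT _ h0]
    have := congrArg (fun f : C(Icc (0 : ℝ) T, ℝ) => f ⟨0, h0⟩) hr
    simpa [primitiveCLM_apply] using this

end PolarFamily

/-! ### Taylor coefficients of the return map from an energy balance. -/

/-- If `f ρ = ρ + ρ ^ m Y ρ` near `0` with `Y` analytic, `m ≥ 2`, then the Taylor coefficient of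
order `m` of `f` at `0` is `Y 0`. -/
theorem iteratedDeriv_div_factorial_of_eq_add_pow_mul {f Y : ℝ → ℝ} {m : ℕ} (hm : 2 ≤ m)
    (hY : AnalyticAt ℝ Y 0) (hf : f =ᶠ[𝓝 0] fun ρ => ρ + ρ ^ m * Y ρ) :
    iteratedDeriv m f 0 / (m.factorial : ℝ) = Y 0 := by
  have hfac : (m.factorial : ℝ) ≠ 0 := by exact_mod_cast m.factorial_ne_zero
  have hYc : ContDiffAt ℝ m Y 0 := hY.contDiffAt
  have hp : ContDiffAt ℝ m (fun ρ : ℝ => ρ ^ m) 0 := contDiffAt_id.pow m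
  rw [hf.iteratedDeriv_eq]
  have hadd : iteratedDeriv m (fun ρ : ℝ => ρ + ρ ^ m * Y ρ) 0
      = iteratedDeriv m (fun ρ : ℝ => ρ ^ 1) 0
        + iteratedDeriv m (fun ρ : ℝ => ρ ^ m * Y ρ) 0 := by
    simp only [pow_one]
    exact iteratedDeriv_fun_add contDiffAt_id (hp.mul hYc)
  rw [hadd, iteratedDeriv_fun_mul hp hYc, iteratedDeriv_fun_pow_zero, if_neg (by omega),
    Finset.sum_eq_single m]
  · rw [iteratedDeriv_fun_pow_zero, if_pos rfl]
    simp
    field_simp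
  · intro i _ hi
    rw [iteratedDeriv_fun_pow_zero, if_neg hi]
    simp
  · simp

/-- `R` is a family of solutions of the polar equation on `[0, T]`, parametrized by the initial
value and analytic at `0`. -/
structure IsPolarFamily (φ : Fin 3 → C(ℝ, ℝ)) {T : ℝ} (hT : 0 ≤ T)
    (R : ℝ → C(Icc (0 : ℝ) T, ℝ)) : Prop where
  analyticAt : AnalyticAt ℝ R 0
  map_zero : R 0 = 0
  hasDerivAt : HasDerivAt R 1 0
  eventually_fixed : ∀ᶠ ρ in 𝓝 0, IsUnit (polarDenOn φ T (R ρ)) ∧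
    R ρ = algebraMap ℝ _ ρ + primitiveCLM hT (polarRhsOn φ T (R ρ))

namespace IsPolarFamily

variable {φ : Fin 3 → C(ℝ, ℝ)} {T : ℝ} {hT : 0 ≤ T} {R : ℝ → C(Icc (0 : ℝ) T, ℝ)}

theorem analyticAt_apply (hR : IsPolarFamily φ hT R) (θ : Icc (0 : ℝ) T) :
    AnalyticAt ℝ (fun ρ => R ρ θ) 0 :=
  ((ContinuousMap.evalCLM ℝ θ : C(Icc (0 : ℝ) T, ℝ) →L[ℝ] ℝ).analyticAt _).comp
    hR.analyticAt

theorem hasDerivAt_apply (hR : IsPolarFamily φ hT R) (θ : Icc (0 : ℝ) T) :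
    HasDerivAt (fun ρ => R ρ θ) 1 0 :=
  (ContinuousMap.evalCLM ℝ θ : C(Icc (0 : ℝ) T, ℝ) →L[ℝ] ℝ).hasFDerivAt.comp_hasDerivAt _
    hR.hasDerivAt

/-- If a function `g` with `g = r ^ 2 / 2` at both ends satisfies
`g' = -r ^ (m + 1) (w₀ + w₁ r ^ 2 + w₂ r ^ 4) / D` along the solutions of the polar equation, then
the Taylor coefficient of order `m` of `ρ ↦ r(T, ρ)` is `-∫ w₀`. -/
theorem iteratedDeriv_eq_neg_integral (hR : IsPolarFamily φ hT R) (w : Fin 3 → C(ℝ, ℝ)) {m : ℕ}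
    (hm : 2 ≤ m)
    (hw : ∀ r : ℝ → ℝ, IsPolarOrbit φ T r → ∃ g : ℝ → ℝ,
      (∀ θ ∈ Icc 0 T, HasDerivWithinAt g
        (-(r θ ^ (m + 1) * evenPoly (fun i => w i θ) (r θ)) /
          (1 - r θ ^ 2 * Real.cos θ * evenPoly (fun i => φ i θ) (r θ))) (Icc 0 T) θ) ∧
      g 0 = r 0 ^ 2 / 2 ∧ g T = r T ^ 2 / 2) :
    iteratedDeriv m (fun ρ => R ρ ⟨T, hT, le_rfl⟩) 0 / (m.factorial : ℝ)
      = -∫ θ in (0 : ℝ)..T, w 0 θ := by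
  set e : Icc (0 : ℝ) T := ⟨T, hT, le_rfl⟩
  -- `S ρ` is `R ρ / ρ`, extended analytically by `S 0 = 1`. It allows `ρ ^ (m + 1)` to be taken out
  -- of the integral.
  set S : ℝ → C(Icc (0 : ℝ) T, ℝ) := dslope R 0 with hS
  have hSa : AnalyticAt ℝ S 0 := by
    obtain ⟨p, hp⟩ := hR.analyticAt
    exact hp.has_fpower_series_dslope_fslope.analyticAt
  have hS0 : S 0 = 1 := by rw [hS, dslope_same, hR.hasDerivAt.deriv]
  have hRS : ∀ ρ, R ρ = ρ • S ρ := fun ρ => by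
    have := sub_smul_dslope R 0 ρ
    rw [hR.map_zero, sub_zero, sub_zero] at this
    exact this.symm
  set Z : ℝ → ℝ := fun ρ => primitiveCLM hT
    (S ρ ^ (m + 1) * evenPolyOn w T (R ρ) * polarInvDenOn φ T (R ρ)) e with hZ
  have hZa : AnalyticAt ℝ Z 0 := by
    have h1 : AnalyticAt ℝ (fun ρ => evenPolyOn w T (R ρ)) 0 :=
      (analyticAt_evenPolyOn w T _).comp hR.analyticAt
    have h2 : AnalyticAt ℝ (fun ρ => polarInvDenOn φ T (R ρ)) 0 :=
      AnalyticAt.fun_comp (by rw [hR.map_zero]; exact analyticAt_polarInvDenOn φ T) hR.analyticAt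
    exact ((ContinuousMap.evalCLM ℝ e).analyticAt _).comp
      (((primitiveCLM hT).analyticAt _).comp (((hSa.pow (m + 1)).mul h1).mul h2))
  have hZ0 : Z 0 = ∫ θ in (0 : ℝ)..T, w 0 θ := by
    simp only [hZ, hS0, hR.map_zero, polarInvDenOn_zero, one_pow, one_mul, mul_one,
      primitiveCLM_apply]
    refine intervalIntegral.integral_congr fun θ hθ => ?_
    rw [uIcc_of_le hT] at hθ
    rw [IccExtend_of_mem hT _ hθ, evenPolyOn_apply]
    simp [evenPoly]
  have hσa : AnalyticAt ℝ (fun ρ => S ρ e) 0 :=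
    ((ContinuousMap.evalCLM ℝ e : C(Icc (0 : ℝ) T, ℝ) →L[ℝ] ℝ).analyticAt _).comp hSa
  have hσ0 : S 0 e + 1 = 2 := by
    rw [hS0]
    norm_num
  have hY : AnalyticAt ℝ (fun ρ => -(2 * Z ρ) / (S ρ e + 1)) 0 := by
    refine AnalyticAt.div (by fun_prop) (by fun_prop) ?_
    rw [hσ0]
    norm_num
  -- The fundamental theorem of calculus for `g`, whose end values are half the squared radii.
  have hbal : ∀ᶠ ρ in 𝓝 0, R ρ e ^ 2 / 2 - ρ ^ 2 / 2 = -(ρ ^ (m + 1) * Z ρ) := by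
    filter_upwards [hR.eventually_fixed] with ρ hρ
    obtain ⟨horb, hini⟩ := isPolarOrbit_of_fixedPoint φ hT hρ.1 hρ.2
    obtain ⟨g, hg, hg0, hgT⟩ := hw _ horb
    have hend : IccExtend hT (R ρ) T = R ρ e := IccExtend_right hT _
    rw [hini] at hg0
    rw [hend] at hgT
    set q : C(Icc (0 : ℝ) T, ℝ) :=
      -(R ρ ^ (m + 1) * evenPolyOn w T (R ρ) * polarInvDenOn φ T (R ρ)) with hq
    have hqc : Continuous (IccExtend hT q) := q.continuous.Icc_extend'
    have hint : ∫ θ in (0 : ℝ)..T, IccExtend hT q θ = g T - g 0 := by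
      refine intervalIntegral.integral_eq_sub_of_hasDerivAt_of_le hT
        (fun θ hθ => (hg θ hθ).continuousWithinAt) (fun θ hθ => ?_) (hqc.intervalIntegrable _ _)
      have hθ' := Ioo_subset_Icc_self hθ
      have h := (hg θ hθ').hasDerivAt (Icc_mem_nhds hθ.1 hθ.2)
      convert h using 1
      rw [IccExtend_of_mem hT _ hθ', IccExtend_of_mem hT _ hθ']
      have : q ⟨θ, hθ'⟩ = -(R ρ ⟨θ, hθ'⟩ ^ (m + 1) * evenPolyOn w T (R ρ) ⟨θ, hθ'⟩
        * polarInvDenOn φ T (R ρ) ⟨θ, hθ'⟩) := rfl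
      rw [this, polarInvDenOn_apply φ T hρ.1, polarDenOn_apply, evenPolyOn_apply]
      ring
    have hJ : primitiveCLM hT q e = -(ρ ^ (m + 1) * Z ρ) := by
      have : q = (-(ρ ^ (m + 1))) •
          (S ρ ^ (m + 1) * evenPolyOn w T (R ρ) * polarInvDenOn φ T (R ρ)) := by
        rw [hq]
        nth_rewrite 1 [hRS ρ]
        rw [smul_pow, smul_mul_assoc, smul_mul_assoc, neg_smul]
      rw [this, map_smul]
      simp [hZ]
    rw [← hgT, ← hg0, ← hint, ← hJ, primitiveCLM_apply]
  have hne : ∀ᶠ ρ in 𝓝 0, S ρ e + 1 ≠ 0 := by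
    refine ContinuousAt.eventually_ne (g := fun ρ => S ρ e + 1)
      (hσa.continuousAt.add continuousAt_const) ?_
    rw [hσ0]
    norm_num
  have hexp : (fun ρ => R ρ e) =ᶠ[𝓝 0] fun ρ => ρ + ρ ^ m * (-(2 * Z ρ) / (S ρ e + 1)) := by
    filter_upwards [hbal, hne] with ρ h1 h2
    have h3 : R ρ e = ρ * S ρ e := by rw [hRS ρ]; rfl
    rw [h3] at h1 ⊢
    by_cases hρ : ρ = 0
    · subst hρ
      have : m ≠ 0 := by omega
      simp [this]
    -- The balance factors as a difference of squares; `S ρ e + 1` is near `2` and can be divided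
    -- out.
    · have h4 : ρ * (S ρ e - 1) * (S ρ e + 1) = -(2 * ρ ^ m * Z ρ) := by
        refine mul_left_cancel₀ hρ ?_
        linear_combination 2 * h1
      field_simp
      linarith
  rw [iteratedDeriv_div_factorial_of_eq_add_pow_mul hm hY hexp, hZ0, hσ0]
  ring

end IsPolarFamily

/-! ### Homogeneous perturbations of the rotation in polar coordinates. -/

/-- `f` is homogeneous of degree `n`. -/
def IsHomogeneousOfDegree (n : ℕ) (f : ℝ × ℝ → ℝ) : Prop :=
  ∀ (r : ℝ) (p : ℝ × ℝ), f (r • p) = r ^ n * f p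

/-- The system `ẋ = y`, `ẏ = -x + f₀(x, y) + f₁(x, y) + f₂(x, y)`. -/
def perturbedRotation (f : Fin 3 → C(ℝ × ℝ, ℝ)) (p : ℝ × ℝ) : ℝ × ℝ :=
  (p.2, -p.1 + (f 0 p + f 1 p + f 2 p))

/-- The restrictions to the unit circle. -/
noncomputable def onCircle (f : Fin 3 → C(ℝ × ℝ, ℝ)) (i : Fin 3) : C(ℝ, ℝ) :=
  (f i).comp ⟨fun θ => (Real.cos θ, Real.sin θ), by fun_prop⟩

theorem onCircle_apply (f : Fin 3 → C(ℝ × ℝ, ℝ)) (i : Fin 3) (θ : ℝ) :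
    onCircle f i θ = f i (Real.cos θ, Real.sin θ) := rfl

theorem sum_apply_polar {f : Fin 3 → C(ℝ × ℝ, ℝ)} {n : ℕ}
    (hf : ∀ i : Fin 3, IsHomogeneousOfDegree (n + 2 * i) (f i)) (r θ : ℝ) :
    f 0 (r * Real.cos θ, r * Real.sin θ) + f 1 (r * Real.cos θ, r * Real.sin θ)
      + f 2 (r * Real.cos θ, r * Real.sin θ)
        = r ^ n * evenPoly (fun i => onCircle f i θ) r := by
  have h : ∀ i : Fin 3, f i (r * Real.cos θ, r * Real.sin θ)
      = r ^ (n + 2 * (i : ℕ)) * f i (Real.cos θ, Real.sin θ) :=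
    fun i => hf i r (Real.cos θ, Real.sin θ)
  rw [h 0, h 1, h 2]
  simp only [evenPoly, onCircle_apply, Fin.val_zero, Fin.val_one, Fin.val_two]
  ring

section PolarForm

variable {f : Fin 3 → C(ℝ × ℝ, ℝ)} (hf : ∀ i : Fin 3, IsHomogeneousOfDegree (3 + 2 * i) (f i))
include hf

theorem radialSpeed_perturbedRotation (θ r : ℝ) :
    radialSpeed (perturbedRotation f) θ r
      = r ^ 3 * Real.sin θ * evenPoly (fun i => onCircle f i θ) r := by
  simp only [radialSpeed, perturbedRotation, sum_apply_polar hf]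
  ring

theorem transverseSpeed_perturbedRotation (θ r : ℝ) :
    transverseSpeed (perturbedRotation f) θ r
      = -(r * (1 - r ^ 2 * Real.cos θ * evenPoly (fun i => onCircle f i θ) r)) := by
  simp only [transverseSpeed, perturbedRotation, sum_apply_polar hf]
  linear_combination (-r) * Real.sin_sq_add_cos_sq θ

theorem isPolarSolution_perturbedRotation_iff {ρ : ℝ} {r : ℝ → ℝ} :
    IsPolarSolution (perturbedRotation f) ρ r ↔
      r 0 = ρ ∧ IsPolarOrbit (onCircle f) (2 * Real.pi) r := by
  refine and_congr_right fun _ => forall₂_congr fun θ _ => ?_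
  rw [radialSpeed_perturbedRotation hf, transverseSpeed_perturbedRotation hf]
  -- At `r = 0` the quotient in the polar equation is `0 / 0 = 0`, which agrees with `polarRhs`, and
  -- the reduced denominator is `1`. Elsewhere the factor `r` cancels.
  by_cases hr : r θ = 0
  · simp [polarRhs, hr]
  · have : r θ * (r θ ^ 3 * Real.sin θ * evenPoly (fun i => onCircle f i θ) (r θ)) /
        -(r θ * (1 - r θ ^ 2 * Real.cos θ * evenPoly (fun i => onCircle f i θ) (r θ)))
        = polarRhs (onCircle f) θ (r θ) := by
      rw [div_neg, mul_div_mul_left _ _ hr, polarRhs, neg_div]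
    rw [this]
    simp [hr]

/-- The return map is defined by an arbitrary choice of solution; uniqueness identifies its end
value with that of the analytic family. -/
theorem exists_isPolarFamily_returnMap :
    ∃ R, IsPolarFamily (onCircle f) Real.two_pi_pos.le R ∧
      PolarWellPosed (perturbedRotation f) ∧
      returnMap (perturbedRotation f) =ᶠ[𝓝 0]
        fun ρ => R ρ ⟨2 * Real.pi, Real.two_pi_pos.le, le_rfl⟩ := by
  obtain ⟨R, h₁, h₂, h₃, h₄⟩ :=
    exists_analytic_polarFamily (onCircle f) Real.two_pi_pos.le
  have hsol : ∀ᶠ ρ in 𝓝 0,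
      IsPolarSolution (perturbedRotation f) ρ (IccExtend Real.two_pi_pos.le (R ρ)) := by
    filter_upwards [h₄] with ρ hρ
    obtain ⟨ho, hi⟩ := isPolarOrbit_of_fixedPoint _ Real.two_pi_pos.le hρ.1 hρ.2
    exact (isPolarSolution_perturbedRotation_iff hf).2 ⟨hi, ho⟩
  have huniq : ∀ {ρ : ℝ} {r r' : ℝ → ℝ}, IsPolarSolution (perturbedRotation f) ρ r →
      IsPolarSolution (perturbedRotation f) ρ r' → EqOn r' r (Icc 0 (2 * Real.pi)) := by
    intro ρ r r' hr hr'
    rw [isPolarSolution_perturbedRotation_iff hf] at hr hr'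
    exact hr'.2.eqOn hr.2 (hr'.1.trans hr.1.symm)
  refine ⟨R, ⟨h₁, h₂, h₃, h₄⟩, ?_, ?_⟩
  · filter_upwards [hsol] with ρ hρ
    exact ⟨_, hρ, fun r' hr' => huniq hρ hr'⟩
  · filter_upwards [hsol] with ρ hρ
    have hex : ∃ r, IsPolarSolution (perturbedRotation f) ρ r := ⟨_, hρ⟩
    rw [returnMap, dif_pos hex]
    have := huniq hρ hex.choose_spec ⟨Real.two_pi_pos.le, le_rfl⟩
    rw [this, IccExtend_right]

theorem polarWellPosed_perturbedRotation : PolarWellPosed (perturbedRotation f) :=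
  let ⟨_, _, h, _⟩ := exists_isPolarFamily_returnMap hf
  h

theorem analyticAt_returnMap_perturbedRotation :
    AnalyticAt ℝ (returnMap (perturbedRotation f)) 0 :=
  let ⟨_, hR, _, h⟩ := exists_isPolarFamily_returnMap hf
  (hR.analyticAt_apply _).congr h.symm

theorem lyapunovConstant_one_perturbedRotation :
    lyapunovConstant (perturbedRotation f) 1 = 1 := by
  obtain ⟨R, hR, _, h⟩ := exists_isPolarFamily_returnMap hf
  rw [lyapunovConstant, h.iteratedDeriv_eq, iteratedDeriv_one, (hR.hasDerivAt_apply _).deriv]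
  simp

/-- If `K` is a function with `K(x, 0) = x² / 2` whose derivative along the field is
`W₀ + W₁ + W₂` with `Wᵢ` homogeneous of degree `m + 1 + 2 i`, then the `m`-th Lyapunov constant is
minus the integral of `W₀` over the unit circle. -/
theorem lyapunovConstant_eq_neg_integral {K Kx Ky : ℝ × ℝ → ℝ} {W : Fin 3 → C(ℝ × ℝ, ℝ)} {m : ℕ}
    (hm : 2 ≤ m)
    (hK : ∀ p, HasFDerivAt K
      (Kx p • ContinuousLinearMap.fst ℝ ℝ ℝ + Ky p • ContinuousLinearMap.snd ℝ ℝ ℝ) p)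
    (hK0 : ∀ x, K (x, 0) = x ^ 2 / 2)
    (hW : ∀ i : Fin 3, IsHomogeneousOfDegree (m + 1 + 2 * i) (W i))
    (hKW : ∀ p : ℝ × ℝ, Kx p * p.2 + Ky p * (-p.1 + (f 0 p + f 1 p + f 2 p))
      = W 0 p + W 1 p + W 2 p) :
    lyapunovConstant (perturbedRotation f) m
      = -∫ θ in (0 : ℝ)..(2 * Real.pi), W 0 (Real.cos θ, Real.sin θ) := by
  obtain ⟨R, hR, _, h⟩ := exists_isPolarFamily_returnMap hf
  rw [lyapunovConstant, h.iteratedDeriv_eq]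
  refine hR.iteratedDeriv_eq_neg_integral (onCircle W) hm fun r hr => ?_
  -- `K` along the orbit has `θ`-derivative `K̇ / θ̇` with `θ̇ = -D`, hence the minus sign. At `θ =
  -- 0` and `θ = 2π` the orbit is on the `x`-axis, where `K` is `x² / 2`.
  refine ⟨fun θ => K (r θ * Real.cos θ, r θ * Real.sin θ), fun θ hθ => ?_, ?_, ?_⟩
  · obtain ⟨hD, hr'⟩ := hr θ hθ
    set p : ℝ × ℝ := (r θ * Real.cos θ, r θ * Real.sin θ) with hp
    have hcurve := (hr'.mul (Real.hasDerivAt_cos θ).hasDerivWithinAt).prodMk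
      (hr'.mul (Real.hasDerivAt_sin θ).hasDerivWithinAt)
    have hg := (hK p).comp_hasDerivWithinAt θ hcurve
    refine hg.congr_deriv ?_
    have h1 := hKW p
    rw [sum_apply_polar hf, sum_apply_polar hW] at h1
    simp only [add_apply, smul_apply, ContinuousLinearMap.coe_fst', ContinuousLinearMap.coe_snd',
      smul_eq_mul]
    rw [← h1, polarRhs]
    have hcs := Real.sin_sq_add_cos_sq θ
    generalize hDe : 1 - r θ ^ 2 * Real.cos θ * evenPoly (fun i => onCircle f i θ) (r θ) = D at hD ⊢
    field_simp
    simp only [hp]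
    linear_combination (r θ * Real.sin θ * Kx p - r θ * Real.cos θ * Ky p) * hDe
      - (r θ ^ 3 * evenPoly (fun i => onCircle f i θ) (r θ)) * Ky p * hcs
  · simp [hK0]
  · simp [hK0]

end PolarForm

/-! ### Binary forms given by coefficient lists, and truncated first integrals. -/

/-- The binary form `∑ lᵢ x ^ (n - i) y ^ i` of degree `n` with coefficients `l`. -/
def binaryForm (n : ℕ) (l : List ℝ) (p : ℝ × ℝ) : ℝ :=
  ∑ i ∈ Finset.range (n + 1), l.getD i 0 * p.1 ^ (n - i) * p.2 ^ i

/-- The derivative of `binaryForm` with respect to `x`. -/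
def binaryFormX (n : ℕ) (l : List ℝ) (p : ℝ × ℝ) : ℝ :=
  ∑ i ∈ Finset.range (n + 1), l.getD i 0 * (((n - i : ℕ) : ℝ) * p.1 ^ (n - i - 1)) * p.2 ^ i

/-- The derivative of `binaryForm` with respect to `y`. -/
def binaryFormY (n : ℕ) (l : List ℝ) (p : ℝ × ℝ) : ℝ :=
  ∑ i ∈ Finset.range (n + 1), l.getD i 0 * p.1 ^ (n - i) * ((i : ℝ) * p.2 ^ (i - 1))

theorem hasFDerivAt_binaryForm (n : ℕ) (l : List ℝ) (p : ℝ × ℝ) :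
    HasFDerivAt (binaryForm n l)
      (binaryFormX n l p • ContinuousLinearMap.fst ℝ ℝ ℝ
        + binaryFormY n l p • ContinuousLinearMap.snd ℝ ℝ ℝ) p := by
  have h : ∀ i ∈ Finset.range (n + 1), HasFDerivAt
      (fun p : ℝ × ℝ => l.getD i 0 * p.1 ^ (n - i) * p.2 ^ i)
      ((l.getD i 0 * (((n - i : ℕ) : ℝ) * p.1 ^ (n - i - 1)) * p.2 ^ i)
          • ContinuousLinearMap.fst ℝ ℝ ℝ
        + (l.getD i 0 * p.1 ^ (n - i) * ((i : ℝ) * p.2 ^ (i - 1)))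
          • ContinuousLinearMap.snd ℝ ℝ ℝ) p := by
    intro i _
    have h1 := ((hasFDerivAt_fst (𝕜 := ℝ) (p := p)).pow (n - i)).const_mul (l.getD i 0)
    have h2 := (hasFDerivAt_snd (𝕜 := ℝ) (p := p)).pow i
    refine (h1.mul h2).congr_fderiv ?_
    ext <;> (simp; try ring)
  refine (HasFDerivAt.fun_sum h).congr_fderiv ?_
  simp only [binaryFormX, binaryFormY, Finset.sum_smul, Finset.sum_add_distrib]

theorem isHomogeneousOfDegree_binaryFormY (n : ℕ) (l : List ℝ) :
    IsHomogeneousOfDegree n (binaryFormY (n + 1) l) := by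
  intro r p
  simp only [binaryFormY, Finset.mul_sum, Prod.smul_fst, Prod.smul_snd, smul_eq_mul]
  refine Finset.sum_congr rfl fun i hi => ?_
  rcases i with _ | i
  · simp
  · have : n = (n - i) + i := by
      have := Finset.mem_range.1 hi
      omega
    have h1 : n + 1 - (i + 1) = n - i := by omega
    rw [h1, Nat.add_sub_cancel]
    nth_rewrite 2 [this]
    ring

theorem continuous_binaryFormY (n : ℕ) (l : List ℝ) : Continuous (binaryFormY n l) := by
  unfold binaryFormY
  fun_prop

theorem binaryForm_apply_zero (n : ℕ) (l : List ℝ) (x : ℝ) :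
    binaryForm n l (x, 0) = l.getD 0 0 * x ^ n := by
  rw [binaryForm, Finset.sum_eq_single 0]
  · simp
  · intro i _ hi
    simp [hi]
  · simp

theorem IsHomogeneousOfDegree.mul {m n : ℕ} {f g : ℝ × ℝ → ℝ} (hf : IsHomogeneousOfDegree m f)
    (hg : IsHomogeneousOfDegree n g) : IsHomogeneousOfDegree (m + n) (fun p => f p * g p) := by
  intro r p
  simp only [hf r p, hg r p]
  ring

theorem IsHomogeneousOfDegree.add {n : ℕ} {f g : ℝ × ℝ → ℝ} (hf : IsHomogeneousOfDegree n f)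
    (hg : IsHomogeneousOfDegree n g) : IsHomogeneousOfDegree n (fun p => f p + g p) := by
  intro r p
  simp only [hf r p, hg r p]
  ring

/-- Bookkeeping for the derivative of a truncated first integral at a point `(u, v)`: `x j`, `y j`
are the partial derivatives of its `j`-th form and `aᵢ` the values of the perturbing forms. Each new
form cancels the lowest remaining degree, so three degrees are always left over. -/
theorem sum_range_balance {x y : ℕ → ℝ} {u v a₀ a₁ a₂ : ℝ} (x0 : x 0 = 0) (x1 : x 1 = 0)
    (y0 : y 0 = 0) (y1 : y 1 = 0) (h2 : x 2 * v - y 2 * u = 0) (N : ℕ)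
    (h : ∀ j < N, x (j + 3) * v - y (j + 3) * u
      + (a₀ * y (j + 2) + a₁ * y (j + 1) + a₂ * y j) = 0) :
    (∑ j ∈ Finset.range (N + 3), x j) * v
        + (∑ j ∈ Finset.range (N + 3), y j) * (-u + (a₀ + a₁ + a₂))
      = (a₀ * y (N + 2) + a₁ * y (N + 1) + a₂ * y N) + (a₁ * y (N + 2) + a₂ * y (N + 1))
        + a₂ * y (N + 2) := by
  induction N with
  | zero =>
    simp only [zero_add, Finset.sum_range_succ, Finset.sum_range_zero, x0, x1, y0, y1]
    linear_combination h2
  | succ N ih =>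
    have ih := ih fun j hj => h j (by omega)
    have hN := h N (by omega)
    rw [show N + 1 + 3 = (N + 3) + 1 by ring, Finset.sum_range_succ x, Finset.sum_range_succ y,
      show N + 1 + 2 = N + 3 by ring, show N + 1 + 1 = N + 2 by ring]
    linear_combination ih + hN

/-- Let `h j = binaryForm (2 j - 2) (c j)` be forms with `h 2 = (x² + y²) / 2`, without a
term `x ^ (2 j - 2)` for `j ≠ 2`. If the forms of degree `4, …, 2 N + 2` in the derivative of
`∑ h j` along the field vanish, then the Lyapunov constant of order `2 N + 3` is given by the form
of degree `2 N + 4`. -/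
theorem lyapunovConstant_eq_of_forms {f : Fin 3 → C(ℝ × ℝ, ℝ)}
    (hf : ∀ i : Fin 3, IsHomogeneousOfDegree (3 + 2 * i) (f i)) (c : ℕ → List ℝ)
    (c0 : c 0 = []) (c1 : c 1 = []) (c2 : c 2 = [1 / 2, 0, 1 / 2])
    (hc : ∀ j, (c (j + 3)).getD 0 0 = 0) (N : ℕ)
    (hbal : ∀ j < N, ∀ p : ℝ × ℝ,
      binaryFormX (2 * (j + 3) - 2) (c (j + 3)) p * p.2
        - binaryFormY (2 * (j + 3) - 2) (c (j + 3)) p * p.1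
        + (f 0 p * binaryFormY (2 * (j + 2) - 2) (c (j + 2)) p
          + f 1 p * binaryFormY (2 * (j + 1) - 2) (c (j + 1)) p
          + f 2 p * binaryFormY (2 * j - 2) (c j) p) = 0) :
    lyapunovConstant (perturbedRotation f) (2 * N + 3)
      = -∫ θ in (0 : ℝ)..(2 * Real.pi), (fun p : ℝ × ℝ =>
          f 0 p * binaryFormY (2 * (N + 2) - 2) (c (N + 2)) p
          + f 1 p * binaryFormY (2 * (N + 1) - 2) (c (N + 1)) p
          + f 2 p * binaryFormY (2 * N - 2) (c N) p) (Real.cos θ, Real.sin θ) := by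
  have hY0 : ∀ n p, binaryFormY n [] p = 0 := fun n p => by simp [binaryFormY]
  have hX0 : ∀ n p, binaryFormX n [] p = 0 := fun n p => by simp [binaryFormX]
  -- For `j = 0, 1` the subtraction in `2 * j - 2` yields degree `0`, but the lists are empty, so
  -- the product is zero and homogeneous of any degree.
  have hprod : ∀ (i : Fin 3) (j : ℕ), IsHomogeneousOfDegree (2 * j + 2 * i)
      (fun p => f i p * binaryFormY (2 * j - 2) (c j) p) := by
    rintro i (_ | _ | j)
    · intro r p
      simp only [c0, hY0, mul_zero]
    · intro r p
      simp only [zero_add, c1, hY0, mul_zero]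
    · have := (hf i).mul (isHomogeneousOfDegree_binaryFormY (2 * j + 1) (c (j + 2)))
      rw [show 2 * (j + 1 + 1) + 2 * (i : ℕ) = 3 + 2 * i + (2 * j + 1) by ring]
      exact this
  have hY : ∀ j, Continuous (binaryFormY (2 * j - 2) (c j)) := fun j => continuous_binaryFormY _ _
  -- The leftover forms, of degrees `2 N + 4`, `2 N + 6`, `2 N + 8`.
  set W : Fin 3 → C(ℝ × ℝ, ℝ) := ![
    ⟨fun p => f 0 p * binaryFormY (2 * (N + 2) - 2) (c (N + 2)) p
      + f 1 p * binaryFormY (2 * (N + 1) - 2) (c (N + 1)) p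
      + f 2 p * binaryFormY (2 * N - 2) (c N) p, by fun_prop⟩,
    ⟨fun p => f 1 p * binaryFormY (2 * (N + 2) - 2) (c (N + 2)) p
      + f 2 p * binaryFormY (2 * (N + 1) - 2) (c (N + 1)) p, by fun_prop⟩,
    ⟨fun p => f 2 p * binaryFormY (2 * (N + 2) - 2) (c (N + 2)) p, by fun_prop⟩] with hW
  refine lyapunovConstant_eq_neg_integral hf (m := 2 * N + 3) (W := W)
    (K := fun p => ∑ j ∈ Finset.range (N + 3), binaryForm (2 * j - 2) (c j) p)
    (Kx := fun p => ∑ j ∈ Finset.range (N + 3), binaryFormX (2 * j - 2) (c j) p)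
    (Ky := fun p => ∑ j ∈ Finset.range (N + 3), binaryFormY (2 * j - 2) (c j) p)
    (by omega) (fun p => ?_) (fun x => ?_) (fun i => ?_) (fun p => ?_)
  · refine (HasFDerivAt.fun_sum fun j _ => hasFDerivAt_binaryForm (2 * j - 2) (c j) p).congr_fderiv ?_
    simp only [Finset.sum_smul, Finset.sum_add_distrib]
  · simp only [binaryForm_apply_zero]
    rw [Finset.sum_eq_single 2]
    · simp [c2]
      ring
    · rintro (_ | _ | _ | j) _ hj
      · simp [c0]
      · simp [c1]
      · exact absurd rfl hj
      · rw [hc j, zero_mul]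
    · simp
  · have h20 := hprod 2 N
    have h21 := hprod 2 (N + 1)
    have h22 := hprod 2 (N + 2)
    have h10 := hprod 1 (N + 1)
    have h11 := hprod 1 (N + 2)
    have h00 := hprod 0 (N + 2)
    fin_cases i
    · exact (h00.add h10).add h20
    · exact h11.add h21
    · exact h22
  · refine sum_range_balance (x := fun j => binaryFormX (2 * j - 2) (c j) p)
      (y := fun j => binaryFormY (2 * j - 2) (c j) p) ?_ ?_ ?_ ?_ ?_ N fun j hj => hbal j hj p
    · simp only [c0, hX0]
    · simp only [c1, hX0]
    · simp only [c0, hY0]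
    · simp only [c1, hY0]
    · simp [c2, binaryFormX, binaryFormY, Finset.sum_range_succ]
      ring

/-! ### Trigonometric moments. -/

/-- The moment `∫ cos ^ i sin ^ j` over a period. -/
noncomputable def trigMoment (i j : ℕ) : ℝ :=
  ∫ θ in (0 : ℝ)..(2 * Real.pi), Real.cos θ ^ i * Real.sin θ ^ j

theorem trigMoment_one (i : ℕ) : trigMoment i 1 = 0 := by
  have h : ∀ θ ∈ uIcc 0 (2 * Real.pi), HasDerivAt (fun θ => -Real.cos θ ^ (i + 1) / (i + 1))
      (Real.cos θ ^ i * Real.sin θ ^ 1) θ := by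
    intro θ _
    refine (((Real.hasDerivAt_cos θ).pow (i + 1)).neg.div_const ((i : ℝ) + 1)).congr_deriv ?_
    have : (i : ℝ) + 1 ≠ 0 := by positivity
    push_cast
    field_simp
  rw [trigMoment, intervalIntegral.integral_eq_sub_of_hasDerivAt h
    (Continuous.intervalIntegrable (by fun_prop) _ _)]
  simp

/-- The derivative of `cos ^ (i + 1) sin ^ (j + 1)` integrates to zero over a period. Lowering the
sine power by two ends at `j = 1`, where the moment vanishes, or at `j = 0`; in even total degree
the cosine power is then even and reduces to `trigMoment 0 0`. -/
theorem trigMoment_add_two (i j : ℕ) :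
    trigMoment i (j + 2) = (j + 1) / (i + 1) * trigMoment (i + 2) j := by
  have h : ∀ θ ∈ uIcc 0 (2 * Real.pi),
      HasDerivAt (fun θ => Real.cos θ ^ (i + 1) * Real.sin θ ^ (j + 1))
        ((j + 1) * (Real.cos θ ^ (i + 2) * Real.sin θ ^ j)
          - (i + 1) * (Real.cos θ ^ i * Real.sin θ ^ (j + 2))) θ := by
    intro θ _
    refine (((Real.hasDerivAt_cos θ).pow (i + 1)).mul
      ((Real.hasDerivAt_sin θ).pow (j + 1))).congr_deriv ?_
    push_cast
    simp only [Pi.pow_apply]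
    ring
  have hint := intervalIntegral.integral_eq_sub_of_hasDerivAt h
    (Continuous.intervalIntegrable (by fun_prop) _ _)
  rw [intervalIntegral.integral_sub (Continuous.intervalIntegrable (by fun_prop) _ _)
    (Continuous.intervalIntegrable (by fun_prop) _ _), intervalIntegral.integral_const_mul,
    intervalIntegral.integral_const_mul] at hint
  have hi : (i : ℝ) + 1 ≠ 0 := by positivity
  simp only [Real.sin_two_pi, Real.sin_zero, ne_eq, Nat.add_eq_zero_iff, one_ne_zero, and_false,
    not_false_eq_true, zero_pow, mul_zero, sub_self] at hint
  simp only [trigMoment]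
  field_simp
  linarith

theorem trigMoment_add_two_zero (i : ℕ) :
    trigMoment (i + 2) 0 = (i + 1) / (i + 2) * trigMoment i 0 := by
  simp only [trigMoment, pow_zero, mul_one, integral_cos_pow]
  simp

theorem trigMoment_zero_zero : trigMoment 0 0 = 2 * Real.pi := by
  simp [trigMoment]

theorem integral_binaryForm (n : ℕ) (l : List ℝ) :
    ∫ θ in (0 : ℝ)..(2 * Real.pi), binaryForm n l (Real.cos θ, Real.sin θ)
      = ∑ i ∈ Finset.range (n + 1), l.getD i 0 * trigMoment (n - i) i := by
  simp only [binaryForm, mul_assoc]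
  rw [intervalIntegral.integral_finsetSum fun i _ =>
    Continuous.intervalIntegrable (by fun_prop) _ _]
  simp only [intervalIntegral.integral_const_mul, trigMoment]

/-! ### The successive Lyapunov constants of the given system. -/

/-- The nonlinear part of the system `ẋ = y`,
`ẏ = -x - k x³ + (e₂ x² + e₁ x⁴ + e₄ y² + e₅ x⁶ + e₆ y⁴) y`, by degree. -/
def nonlinearForms (k e₁ e₂ e₄ e₅ e₆ : ℝ) : Fin 3 → C(ℝ × ℝ, ℝ) :=
  ![⟨fun p => -k * p.1 ^ 3 + (e₂ * p.1 ^ 2 + e₄ * p.2 ^ 2) * p.2, by fun_prop⟩,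
    ⟨fun p => (e₁ * p.1 ^ 4 + e₆ * p.2 ^ 4) * p.2, by fun_prop⟩,
    ⟨fun p => e₅ * p.1 ^ 6 * p.2, by fun_prop⟩]

section Apply

variable (k e₁ e₂ e₄ e₅ e₆ : ℝ) (p : ℝ × ℝ)

theorem nonlinearForms_zero : nonlinearForms k e₁ e₂ e₄ e₅ e₆ 0 p
    = -k * p.1 ^ 3 + (e₂ * p.1 ^ 2 + e₄ * p.2 ^ 2) * p.2 := rfl

theorem nonlinearForms_one : nonlinearForms k e₁ e₂ e₄ e₅ e₆ 1 p
    = (e₁ * p.1 ^ 4 + e₆ * p.2 ^ 4) * p.2 := rfl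

theorem nonlinearForms_two : nonlinearForms k e₁ e₂ e₄ e₅ e₆ 2 p = e₅ * p.1 ^ 6 * p.2 := rfl

theorem isHomogeneousOfDegree_nonlinearForms (i : Fin 3) :
    IsHomogeneousOfDegree (3 + 2 * i) (nonlinearForms k e₁ e₂ e₄ e₅ e₆ i) := by
  intro r p
  fin_cases i
  · simp only [Fin.zero_eta, nonlinearForms_zero, Prod.smul_fst, Prod.smul_snd, smul_eq_mul]
    ring
  · simp only [Fin.mk_one, nonlinearForms_one, Prod.smul_fst, Prod.smul_snd, smul_eq_mul]
    ring
  · simp only [Fin.reduceFinMk, nonlinearForms_two, Prod.smul_fst, Prod.smul_snd, smul_eq_mul]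
    ring

end Apply

/-- The coefficients of a formal first integral: entry `j` is a form of degree `2 j - 2`. -/
noncomputable def firstIntegralCoeff (k e₄ e₆ : ℝ) : ℕ → List ℝ
  | 2 => [1 / 2, 0, 1 / 2]
  | 3 => [0, 0, -1/2 * k, -e₄, -1/4 * k]
  | 4 => [0, 0, 1/2 * k ^ 2, -5/3 * e₆ + k * e₄, 9/4 * e₄ ^ 2 + 3/4 * k ^ 2, -e₆ + k * e₄, 1/4 *
    e₄ ^ 2 + 1/4 * k ^ 2]
  | 5 => [0, 0, -1/2 * k ^ 3, 2/5 * e₄ ^ 3 + 2/3 * k * e₆ - k ^ 2 * e₄, 15/2 * e₄ * e₆ - 9/4 * k *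
    e₄ ^ 2 - 3/2 * k ^ 3, -5 * e₄ ^ 3 + 8/3 * k * e₆ - 3 * k ^ 2 * e₄, 20/3 * e₄ * e₆ - 15/4 * k *
    e₄ ^ 2 - 5/4 * k ^ 3, -3/2 * e₄ ^ 3 + k * e₆ - 3/2 * k ^ 2 * e₄, 2/3 * e₄ * e₆ - 5/16 * k * e₄
    ^ 2 - 5/16 * k ^ 3]
  | 6 => [0, 0, 1/2 * k ^ 4, -4/5 * k * e₄ ^ 3 + 1/3 * k ^ 2 * e₆ + k ^ 3 * e₄, 25/4 * e₆ ^ 2 -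
    9/5 * e₄ ^ 4 - 3 * k * e₄ * e₆ + 9/4 * k ^ 2 * e₄ ^ 2 + 5/2 * k ^ 4, -27 * e₄ ^ 2 * e₆ + 91/25
    * k * e₄ ^ 3 - 18/5 * k ^ 2 * e₆ + 6 * k ^ 3 * e₄, 125/12 * e₆ ^ 2 + 109/10 * e₄ ^ 4 - 53/3 *
    k * e₄ * e₆ + 21/2 * k ^ 2 * e₄ ^ 2 + 15/4 * k ^ 4, -465/14 * e₄ ^ 2 * e₆ + 827/70 * k * e₄ ^
    3 - 9/2 * k ^ 2 * e₆ + 15/2 * k ^ 3 * e₄, 55/12 * e₆ ^ 2 + 501/80 * e₄ ^ 4 - 121/12 * k * e₄ *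
    e₆ + 61/8 * k ^ 2 * e₄ ^ 2 + 35/16 * k ^ 4, -311/42 * e₄ ^ 2 * e₆ + 159/70 * k * e₄ ^ 3 - 7/6
    * k ^ 2 * e₆ + 5/2 * k ^ 3 * e₄, 5/12 * e₆ ^ 2 + 81/400 * e₄ ^ 4 - 49/60 * k * e₄ * e₆ + 19/40
    * k ^ 2 * e₄ ^ 2 + 7/16 * k ^ 4]
  | _ => []

theorem lyapunovConstant_nonlinearForms (k e₁ e₂ e₄ e₅ e₆ : ℝ) (N : ℕ)
    (hbal : ∀ j < N, ∀ p : ℝ × ℝ,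
      binaryFormX (2 * (j + 3) - 2) (firstIntegralCoeff k e₄ e₆ (j + 3)) p * p.2
        - binaryFormY (2 * (j + 3) - 2) (firstIntegralCoeff k e₄ e₆ (j + 3)) p * p.1
        + (nonlinearForms k e₁ e₂ e₄ e₅ e₆ 0 p
            * binaryFormY (2 * (j + 2) - 2) (firstIntegralCoeff k e₄ e₆ (j + 2)) p
          + nonlinearForms k e₁ e₂ e₄ e₅ e₆ 1 p
            * binaryFormY (2 * (j + 1) - 2) (firstIntegralCoeff k e₄ e₆ (j + 1)) p
          + nonlinearForms k e₁ e₂ e₄ e₅ e₆ 2 p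
            * binaryFormY (2 * j - 2) (firstIntegralCoeff k e₄ e₆ j) p) = 0)
    {w : List ℝ}
    (hw : ∀ p : ℝ × ℝ, nonlinearForms k e₁ e₂ e₄ e₅ e₆ 0 p
            * binaryFormY (2 * (N + 2) - 2) (firstIntegralCoeff k e₄ e₆ (N + 2)) p
          + nonlinearForms k e₁ e₂ e₄ e₅ e₆ 1 p
            * binaryFormY (2 * (N + 1) - 2) (firstIntegralCoeff k e₄ e₆ (N + 1)) p
          + nonlinearForms k e₁ e₂ e₄ e₅ e₆ 2 p
            * binaryFormY (2 * N - 2) (firstIntegralCoeff k e₄ e₆ N) p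
        = binaryForm (2 * N + 4) w p) :
    lyapunovConstant (perturbedRotation (nonlinearForms k e₁ e₂ e₄ e₅ e₆)) (2 * N + 3)
      = -∑ i ∈ Finset.range (2 * N + 5), w.getD i 0 * trigMoment (2 * N + 4 - i) i := by
  rw [lyapunovConstant_eq_of_forms (isHomogeneousOfDegree_nonlinearForms k e₁ e₂ e₄ e₅ e₆)
    (firstIntegralCoeff k e₄ e₆) rfl rfl rfl ?_ N hbal]
  · simp only [hw, integral_binaryForm]
  · rintro (_ | _ | _ | _ | j) <;> rfl

section Stages

variable (k e₁ e₂ e₄ e₅ e₆ : ℝ)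

/-- The kernel of `y ∂x - x ∂y` on forms of degree `2n` is spanned by `(x² + y²)^n`. The lists in
`firstIntegralCoeff` use this freedom to remove the pure power of `x`, and they have `e₂`, `e₁`,
`e₅` already eliminated by the preceding vanishing conditions. -/
theorem firstIntegral_balance_four (p : ℝ × ℝ) :
    binaryFormX (2 * (0 + 3) - 2) (firstIntegralCoeff k e₄ e₆ (0 + 3)) p * p.2
        - binaryFormY (2 * (0 + 3) - 2) (firstIntegralCoeff k e₄ e₆ (0 + 3)) p * p.1
        + (nonlinearForms k e₁ (-3 * e₄) e₄ e₅ e₆ 0 p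
            * binaryFormY (2 * (0 + 2) - 2) (firstIntegralCoeff k e₄ e₆ (0 + 2)) p
          + nonlinearForms k e₁ (-3 * e₄) e₄ e₅ e₆ 1 p
            * binaryFormY (2 * (0 + 1) - 2) (firstIntegralCoeff k e₄ e₆ (0 + 1)) p
          + nonlinearForms k e₁ (-3 * e₄) e₄ e₅ e₆ 2 p
            * binaryFormY (2 * 0 - 2) (firstIntegralCoeff k e₄ e₆ 0) p) = 0 := by
  simp [nonlinearForms_zero, nonlinearForms_one, nonlinearForms_two, firstIntegralCoeff,
    binaryFormX, binaryFormY, Finset.sum_range_succ]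
  ring

theorem firstIntegral_balance_six (p : ℝ × ℝ) :
    binaryFormX (2 * (1 + 3) - 2) (firstIntegralCoeff k e₄ e₆ (1 + 3)) p * p.2
        - binaryFormY (2 * (1 + 3) - 2) (firstIntegralCoeff k e₄ e₆ (1 + 3)) p * p.1
        + (nonlinearForms k (-5 * e₆ - 3 * k * e₄) (-3 * e₄) e₄ e₅ e₆ 0 p
            * binaryFormY (2 * (1 + 2) - 2) (firstIntegralCoeff k e₄ e₆ (1 + 2)) p
          + nonlinearForms k (-5 * e₆ - 3 * k * e₄) (-3 * e₄) e₄ e₅ e₆ 1 p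
            * binaryFormY (2 * (1 + 1) - 2) (firstIntegralCoeff k e₄ e₆ (1 + 1)) p
          + nonlinearForms k (-5 * e₆ - 3 * k * e₄) (-3 * e₄) e₄ e₅ e₆ 2 p
            * binaryFormY (2 * 1 - 2) (firstIntegralCoeff k e₄ e₆ 1) p) = 0 := by
  simp [nonlinearForms_zero, nonlinearForms_one, nonlinearForms_two, firstIntegralCoeff,
    binaryFormX, binaryFormY, Finset.sum_range_succ]
  ring

theorem firstIntegral_balance_eight (p : ℝ × ℝ) :
    binaryFormX (2 * (2 + 3) - 2) (firstIntegralCoeff k e₄ e₆ (2 + 3)) p * p.2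
        - binaryFormY (2 * (2 + 3) - 2) (firstIntegralCoeff k e₄ e₆ (2 + 3)) p * p.1
        + (nonlinearForms k (-5 * e₆ - 3 * k * e₄) (-3 * e₄) e₄
              (6 / 5 * e₄ ^ 3 - 8 * k * e₆) e₆ 0 p
            * binaryFormY (2 * (2 + 2) - 2) (firstIntegralCoeff k e₄ e₆ (2 + 2)) p
          + nonlinearForms k (-5 * e₆ - 3 * k * e₄) (-3 * e₄) e₄
              (6 / 5 * e₄ ^ 3 - 8 * k * e₆) e₆ 1 p
            * binaryFormY (2 * (2 + 1) - 2) (firstIntegralCoeff k e₄ e₆ (2 + 1)) p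
          + nonlinearForms k (-5 * e₆ - 3 * k * e₄) (-3 * e₄) e₄
              (6 / 5 * e₄ ^ 3 - 8 * k * e₆) e₆ 2 p
            * binaryFormY (2 * 2 - 2) (firstIntegralCoeff k e₄ e₆ 2) p) = 0 := by
  simp [nonlinearForms_zero, nonlinearForms_one, nonlinearForms_two, firstIntegralCoeff,
    binaryFormX, binaryFormY, Finset.sum_range_succ]
  ring

theorem firstIntegral_balance_ten
    (h : 9 / 32 * e₄ ^ 2 * e₆ + 9 / 80 * k * e₄ ^ 3 - 21 / 128 * k ^ 2 * e₆ = 0) (p : ℝ × ℝ) :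
    binaryFormX (2 * (3 + 3) - 2) (firstIntegralCoeff k e₄ e₆ (3 + 3)) p * p.2
        - binaryFormY (2 * (3 + 3) - 2) (firstIntegralCoeff k e₄ e₆ (3 + 3)) p * p.1
        + (nonlinearForms k (-5 * e₆ - 3 * k * e₄) (-3 * e₄) e₄
              (6 / 5 * e₄ ^ 3 - 8 * k * e₆) e₆ 0 p
            * binaryFormY (2 * (3 + 2) - 2) (firstIntegralCoeff k e₄ e₆ (3 + 2)) p
          + nonlinearForms k (-5 * e₆ - 3 * k * e₄) (-3 * e₄) e₄
              (6 / 5 * e₄ ^ 3 - 8 * k * e₆) e₆ 1 p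
            * binaryFormY (2 * (3 + 1) - 2) (firstIntegralCoeff k e₄ e₆ (3 + 1)) p
          + nonlinearForms k (-5 * e₆ - 3 * k * e₄) (-3 * e₄) e₄
              (6 / 5 * e₄ ^ 3 - 8 * k * e₆) e₆ 2 p
            * binaryFormY (2 * 3 - 2) (firstIntegralCoeff k e₄ e₆ 3) p) = 0 := by
  simp [nonlinearForms_zero, nonlinearForms_one, nonlinearForms_two, firstIntegralCoeff,
    binaryFormX, binaryFormY, Finset.sum_range_succ]
  -- All coefficients cancel identically except that of `y ^ 10`, which is a multiple of the ninth
  -- Lyapunov constant.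
  linear_combination (-128 / 63) * p.2 ^ 10 * h

theorem lyapunovConstant_three :
    lyapunovConstant (perturbedRotation (nonlinearForms k e₁ e₂ e₄ e₅ e₆)) 3
      = -(Real.pi / 4) * (e₂ + 3 * e₄) := by
  rw [lyapunovConstant_nonlinearForms k _ _ _ _ _ 0
    (w := [0, -k, e₂, 0, e₄]) (fun j hj => absurd hj (Nat.not_lt_zero j)) ?_]
  · simp [Finset.sum_range_succ, trigMoment_add_two, trigMoment_one, trigMoment_add_two_zero,
      trigMoment_zero_zero]
    ring
  · intro p
    simp [nonlinearForms_zero, nonlinearForms_one, nonlinearForms_two, firstIntegralCoeff,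
      binaryForm, binaryFormY, Finset.sum_range_succ]
    ring

theorem lyapunovConstant_five :
    lyapunovConstant (perturbedRotation (nonlinearForms k e₁ (-3 * e₄) e₄ e₅ e₆)) 5
      = -(Real.pi / 8) * (e₁ + 5 * e₆ + 3 * k * e₄) := by
  rw [lyapunovConstant_nonlinearForms k _ _ _ _ _ 1
    (w := [0, k ^ 2, e₁ + 6 * k * e₄, 9 * e₄ ^ 2 + k ^ 2, 2 * k * e₄, -3 * e₄ ^ 2, e₆ - k * e₄]) ?_ ?_]
  · simp [Finset.sum_range_succ, trigMoment_add_two, trigMoment_one, trigMoment_add_two_zero,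
      trigMoment_zero_zero]
    ring
  · intro j hj p
    interval_cases j
    · exact firstIntegral_balance_four k _ _ _ _ p
  · intro p
    simp [nonlinearForms_zero, nonlinearForms_one, nonlinearForms_two, firstIntegralCoeff,
      binaryForm, binaryFormY, Finset.sum_range_succ]
    ring

theorem lyapunovConstant_seven :
    lyapunovConstant (perturbedRotation (nonlinearForms k (-5 * e₆ - 3 * k * e₄) (-3 * e₄) e₄ e₅ e₆)) 7
      = -(Real.pi / 64) * (-6 * e₄ ^ 3 + 5 * e₅ + 40 * k * e₆) := by
  rw [lyapunovConstant_nonlinearForms k _ _ _ _ _ 2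
    (w := [0, -k ^ 3, e₅ + 10 * k * e₆ - 3 * k ^ 2 * e₄, 30 * e₄ * e₆ - 9 * k * e₄ ^ 2 - 3 * k ^
      3, -27 * e₄ ^ 3 + 10 * k * e₆ - 10 * k ^ 2 * e₄, 10 * e₄ * e₆ - 27/2 * k * e₄ ^ 2 - 3/2 * k
      ^ 3, 9/2 * e₄ ^ 3 - k * e₆ - 3/2 * k ^ 2 * e₄, -8 * e₄ * e₆ + 5 * k * e₄ ^ 2, 3/2 * e₄ ^ 3 -
      k * e₆ + 3/2 * k ^ 2 * e₄]) ?_ ?_]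
  · simp [Finset.sum_range_succ, trigMoment_add_two, trigMoment_one, trigMoment_add_two_zero,
      trigMoment_zero_zero]
    ring
  · intro j hj p
    interval_cases j
    · exact firstIntegral_balance_four k _ _ _ _ p
    · exact firstIntegral_balance_six k _ _ _ p
  · intro p
    simp [nonlinearForms_zero, nonlinearForms_one, nonlinearForms_two, firstIntegralCoeff,
      binaryForm, binaryFormY, Finset.sum_range_succ]
    ring

theorem lyapunovConstant_nine :
    lyapunovConstant (perturbedRotation (nonlinearForms k (-5 * e₆ - 3 * k * e₄) (-3 * e₄) e₄
        (6 / 5 * e₄ ^ 3 - 8 * k * e₆) e₆)) 9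
      = Real.pi * (9 / 32 * e₄ ^ 2 * e₆ + 9 / 80 * k * e₄ ^ 3 - 21 / 128 * k ^ 2 * e₆) := by
  rw [lyapunovConstant_nonlinearForms k _ _ _ _ _ 3
    (w := [0, k ^ 4, -12/5 * k * e₄ ^ 3 + k ^ 2 * e₆ + 3 * k ^ 3 * e₄, 25 * e₆ ^ 2 - 36/5 * e₄ ^ 4
      - 12 * k * e₄ * e₆ + 9 * k ^ 2 * e₄ ^ 2 + 6 * k ^ 4, -135 * e₄ ^ 2 * e₆ + 119/5 * k * e₄ ^ 3
      - 61/3 * k ^ 2 * e₆ + 23 * k ^ 3 * e₄, 25 * e₆ ^ 2 + 381/5 * e₄ ^ 4 - 88 * k * e₄ * e₆ +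
      99/2 * k ^ 2 * e₄ ^ 2 + 15/2 * k ^ 4, -195/2 * e₄ ^ 2 * e₆ + 129/2 * k * e₄ ^ 3 - 27/2 * k ^
      2 * e₆ + 45/2 * k ^ 3 * e₄, -5 * e₆ ^ 2 + 13/2 * e₄ ^ 4 - 10 * k * e₄ * e₆ + 19 * k ^ 2 * e₄
      ^ 2 + 5/2 * k ^ 4, 33 * e₄ ^ 2 * e₆ - 15 * k * e₄ ^ 3 + 3 * k ^ 2 * e₆, -5 * e₆ ^ 2 - 21/2 *
      e₄ ^ 4 + 12 * k * e₄ * e₆ - 21/2 * k ^ 2 * e₄ ^ 2, 41/6 * e₄ ^ 2 * e₆ - 5/2 * k * e₄ ^ 3 +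
      3/2 * k ^ 2 * e₆ - 5/2 * k ^ 3 * e₄]) ?_ ?_]
  · simp [Finset.sum_range_succ, trigMoment_add_two, trigMoment_one, trigMoment_add_two_zero,
      trigMoment_zero_zero]
    ring
  · intro j hj p
    interval_cases j
    · exact firstIntegral_balance_four k _ _ _ _ p
    · exact firstIntegral_balance_six k _ _ _ p
    · exact firstIntegral_balance_eight k _ _ p
  · intro p
    simp [nonlinearForms_zero, nonlinearForms_one, nonlinearForms_two, firstIntegralCoeff,
      binaryForm, binaryFormY, Finset.sum_range_succ]
    ring

theorem lyapunovConstant_eleven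
    (h : 9 / 32 * e₄ ^ 2 * e₆ + 9 / 80 * k * e₄ ^ 3 - 21 / 128 * k ^ 2 * e₆ = 0) :
    lyapunovConstant (perturbedRotation (nonlinearForms k (-5 * e₆ - 3 * k * e₄) (-3 * e₄) e₄
        (6 / 5 * e₄ ^ 3 - 8 * k * e₆) e₆)) 11
      = -(2 * Real.pi) * (-29/192 * e₄ * e₆ ^ 2 + 21/1280 * e₄ ^ 5 + 47/256 * k * e₄ ^ 2 * e₆ + 387/2560 * k ^ 2 * e₄ ^ 3 
          - 63/256 * k ^ 3 * e₆) := by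
  rw [lyapunovConstant_nonlinearForms k _ _ _ _ _ 4
    (w := [0, -k ^ 5, 18/5 * k ^ 2 * e₄ ^ 3 - 4 * k ^ 3 * e₆ - 3 * k ^ 4 * e₄, -12 * e₄ ^ 3 * e₆ +
      5 * k * e₆ ^ 2 + 72/5 * k * e₄ ^ 4 - 6 * k ^ 2 * e₄ * e₆ - 9 * k ^ 3 * e₄ ^ 2 - 10 * k ^ 5,
      -225 * e₄ * e₆ ^ 2 + 162/5 * e₄ ^ 5 + 54 * k * e₄ ^ 2 * e₆ - 73/5 * k ^ 2 * e₄ ^ 3 + 24 * k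
      ^ 3 * e₆ - 41 * k ^ 4 * e₄, 524 * e₄ ^ 3 * e₆ - 535/6 * k * e₆ ^ 2 - 207/5 * k * e₄ ^ 4 +
      156 * k ^ 2 * e₄ * e₆ - 105 * k ^ 3 * e₄ ^ 2 - 45/2 * k ^ 5, -725/2 * e₄ * e₆ ^ 2 - 1008/5 *
      e₄ ^ 5 + 519 * k * e₄ ^ 2 * e₆ - 967/5 * k ^ 2 * e₄ ^ 3 + 56 * k ^ 3 * e₆ - 175/2 * k ^ 4 *
      e₄, 3081/5 * e₄ ^ 3 * e₆ - 209/3 * k * e₆ ^ 2 - 497/2 * k * e₄ ^ 4 + 557/3 * k ^ 2 * e₄ * e₆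
      - 157 * k ^ 3 * e₄ ^ 2 - 35/2 * k ^ 5, -265/6 * e₄ * e₆ ^ 2 - 849/10 * e₄ ^ 5 + 1331/7 * k *
      e₄ ^ 2 * e₆ - 4653/35 * k ^ 2 * e₄ ^ 3 + 17 * k ^ 3 * e₆ - 45 * k ^ 4 * e₄, -403/7 * e₄ ^ 3
      * e₆ + 55/6 * k * e₆ ^ 2 + 5417/280 * k * e₄ ^ 4 - 41/6 * k ^ 2 * e₄ * e₆ - 79/4 * k ^ 3 *
      e₄ ^ 2 - 35/8 * k ^ 5, 385/6 * e₄ * e₆ ^ 2 + 1761/40 * e₄ ^ 5 - 236/3 * k * e₄ ^ 2 * e₆ +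
      187/4 * k ^ 2 * e₄ ^ 3 - 15/2 * k ^ 3 * e₆ + 35/8 * k ^ 4 * e₄, -540/7 * e₄ ^ 3 * e₆ + 7 * k
      * e₆ ^ 2 + 1431/70 * k * e₄ ^ 4 - 21 * k ^ 2 * e₄ * e₆ + 45/2 * k ^ 3 * e₄ ^ 2, 19/2 * e₄ *
      e₆ ^ 2 + 81/40 * e₄ ^ 5 - 32/3 * k * e₄ ^ 2 * e₆ + 19/4 * k ^ 2 * e₄ ^ 3 - 5/2 * k ^ 3 * e₆
      + 35/8 * k ^ 4 * e₄]) ?_ ?_]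
  · simp [Finset.sum_range_succ, trigMoment_add_two, trigMoment_one, trigMoment_add_two_zero,
      trigMoment_zero_zero]
    ring
  · intro j hj p
    interval_cases j
    · exact firstIntegral_balance_four k _ _ _ _ p
    · exact firstIntegral_balance_six k _ _ _ p
    · exact firstIntegral_balance_eight k _ _ p
    · exact firstIntegral_balance_ten k _ _ h p
  · intro p
    simp [nonlinearForms_zero, nonlinearForms_one, nonlinearForms_two, firstIntegralCoeff,
      binaryForm, binaryFormY, Finset.sum_range_succ]
    ring

end Stages

/-! ### The Duffing oscillator and its centre. -/

/-- The scalar equation `ψ' = S(ψ)` with `S` continuous, periodic and `0 < S ≤ 1` has global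
solutions which advance by one period of `S` in a fixed time. -/
theorem exists_rotating_solution {S : ℝ → ℝ} (hS : Continuous S) (hpos : ∀ φ, 0 < S φ)
    (hle : ∀ φ, S φ ≤ 1) {L : ℝ} (hL : 0 < L) (hper : Function.Periodic S L) (φ₀ : ℝ) :
    ∃ (ψ : ℝ → ℝ) (T : ℝ), 0 < T ∧ ψ 0 = φ₀ ∧ (∀ t, HasDerivAt ψ (S (ψ t)) t) ∧
      (∀ t, ψ (t + T) = ψ t + L) ∧ Function.Surjective ψ := by
  have hc : Continuous fun φ => (S φ)⁻¹ := hS.inv₀ fun φ => (hpos φ).ne'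
  -- Separation of variables: `τ φ` is the time at which the phase is `φ`, and the solution is its
  -- inverse. Since `S ≤ 1`, `τ` grows at least as fast as `φ` and is onto.
  set τ : ℝ → ℝ := fun φ => ∫ t in φ₀..φ, (S t)⁻¹ with hτ
  have hint : ∀ a b, IntervalIntegrable (fun φ => (S φ)⁻¹) MeasureTheory.volume a b :=
    fun a b => hc.intervalIntegrable a b
  have hd : ∀ φ, HasDerivAt τ (S φ)⁻¹ φ := fun φ =>
    intervalIntegral.integral_hasDerivAt_right (hint _ _) (hc.stronglyMeasurableAtFilter _ _)
      hc.continuousAt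
  have hmono : StrictMono τ := strictMono_of_deriv_pos fun φ => by
    rw [(hd φ).deriv]
    exact inv_pos.2 (hpos φ)
  have hτc : Continuous τ := continuous_iff_continuousAt.2 fun φ => (hd φ).continuousAt
  have hτ0 : τ φ₀ = 0 := intervalIntegral.integral_same
  have hmono' : Monotone fun φ => τ φ - φ := by
    refine monotone_of_deriv_nonneg (fun φ => ((hd φ).sub (hasDerivAt_id φ)).differentiableAt)
      fun φ => ?_
    have : HasDerivAt (fun φ => τ φ - φ) ((S φ)⁻¹ - 1) φ := (hd φ).sub (hasDerivAt_id φ)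
    rw [this.deriv, sub_nonneg]
    exact (one_le_inv₀ (hpos φ)).2 (hle φ)
  have htop : Tendsto τ atTop atTop := by
    refine tendsto_atTop_mono' _ ?_ (tendsto_atTop_add_const_right _ (-φ₀) tendsto_id)
    filter_upwards [eventually_ge_atTop φ₀] with φ hφ
    have := hmono' hφ
    simp only [hτ0] at this
    simp only [id]
    linarith
  have hbot : Tendsto τ atBot atBot := by
    refine tendsto_atBot_mono' _ ?_ (tendsto_atBot_add_const_right _ (-φ₀) tendsto_id)
    filter_upwards [eventually_le_atBot φ₀] with φ hφ
    have := hmono' hφ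
    simp only [hτ0] at this
    simp only [id]
    linarith
  have hsurj : Function.Surjective τ := hτc.surjective htop hbot
  set e : ℝ ≃o ℝ := hmono.orderIsoOfSurjective τ hsurj with he
  have heτ : ∀ φ, e φ = τ φ := fun φ => rfl
  have hτe : ∀ t, τ (e.symm t) = t := fun t => e.apply_symm_apply t
  set T : ℝ := ∫ t in (0 : ℝ)..L, (S t)⁻¹ with hT
  have hshift : ∀ φ, τ (φ + L) = τ φ + T := by
    intro φ
    have hper' : Function.Periodic (fun φ => (S φ)⁻¹) L := fun φ => by simp only [hper φ]
    have h1 := hper'.intervalIntegral_add_eq φ 0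
    rw [zero_add] at h1
    rw [hT, ← h1]
    exact (intervalIntegral.integral_add_adjacent_intervals (hint _ _) (hint _ _)).symm
  have hTpos : 0 < T := by
    have := hshift φ₀
    rw [hτ0, zero_add] at this
    rw [← this, ← hτ0]
    exact hmono (by linarith)
  refine ⟨e.symm, T, hTpos, ?_, fun t => ?_, fun t => ?_, e.symm.surjective⟩
  · rw [OrderIso.symm_apply_eq, heτ, hτ0]
  · have := HasDerivAt.of_local_left_inverse (f := τ) (g := e.symm) (a := t)
      e.symm.continuous.continuousAt (hd _) (inv_ne_zero (hpos _).ne') (Eventually.of_forall hτe)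
    rwa [inv_inv] at this
  · rw [OrderIso.symm_apply_eq, heτ, hshift, hτe]

/-- The Duffing field `ẋ = y`, `ẏ = -x - k x³`. -/
def duffingField (k : ℝ) (p : ℝ × ℝ) : ℝ × ℝ := (p.2, -p.1 - k * p.1 ^ 3)

theorem isHamiltonianField_duffingField (k : ℝ) : IsHamiltonianField (duffingField k) := by
  refine ⟨fun p => p.2 ^ 2 / 2 + p.1 ^ 2 / 2 + k / 4 * p.1 ^ 4, by fun_prop, fun p => ?_⟩
  have h : HasFDerivAt (fun p : ℝ × ℝ => p.2 ^ 2 / 2 + p.1 ^ 2 / 2 + k / 4 * p.1 ^ 4)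
      ((p.1 + k * p.1 ^ 3) • ContinuousLinearMap.fst ℝ ℝ ℝ
        + p.2 • ContinuousLinearMap.snd ℝ ℝ ℝ) p := by
    have hx := hasFDerivAt_fst (𝕜 := ℝ) (p := p)
    have hy := hasFDerivAt_snd (𝕜 := ℝ) (p := p)
    refine ((((hy.pow 2).mul_const (2⁻¹ : ℝ)).add ((hx.pow 2).mul_const (2⁻¹ : ℝ))).add
      ((hx.pow 4).const_mul (k / 4))).congr_fderiv ?_
    ext <;> (simp; try ring)
  rw [h.fderiv]
  simp [duffingField]
  ring

section Duffing

variable (k : ℝ)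

/-- The angular speed on the Duffing orbit of amplitude `A` in the parametrization
`x = A sin φ`. -/
noncomputable def duffingSpeed (A φ : ℝ) : ℝ :=
  √(1 + k / 2 * A ^ 2 * (1 + Real.sin φ ^ 2))

/-- The orbit of amplitude `A`. -/
noncomputable def duffingOrbit (A φ : ℝ) : ℝ × ℝ :=
  (A * Real.sin φ, A * Real.cos φ * duffingSpeed k A φ)

variable {k} (hk : k < 0) {A : ℝ} (hA : 0 < 1 + k * A ^ 2)
include hk hA

/-- For `k < 0` the expression is at least `1 + k A²`. Its positivity says that the amplitude stays
below the saddles at `x² = -1/k`. -/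
theorem duffingSpeed_arg_pos (φ : ℝ) : 0 < 1 + k / 2 * A ^ 2 * (1 + Real.sin φ ^ 2) := by
  have h1 := Real.sin_sq_le_one φ
  have h2 : 0 ≤ -k * A ^ 2 := by nlinarith [sq_nonneg A]
  nlinarith

theorem duffingSpeed_pos (φ : ℝ) : 0 < duffingSpeed k A φ :=
  Real.sqrt_pos.2 (duffingSpeed_arg_pos hk hA φ)

theorem duffingSpeed_sq (φ : ℝ) :
    duffingSpeed k A φ ^ 2 = 1 + k / 2 * A ^ 2 * (1 + Real.sin φ ^ 2) :=
  Real.sq_sqrt (duffingSpeed_arg_pos hk hA φ).le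

omit hA in
theorem duffingSpeed_le_one (φ : ℝ) : duffingSpeed k A φ ≤ 1 := by
  rw [duffingSpeed, Real.sqrt_le_one]
  have : 0 ≤ -k * (A ^ 2 * (1 + Real.sin φ ^ 2)) := mul_nonneg (by linarith) (by positivity)
  linarith

/-- With `x = A sin φ`, conservation of `y² + x² + (k/2) x⁴` gives `y = A cos φ · S(φ)`, and `ẋ = y`
then asks for `φ̇ = S(φ)`. In the derivative of `S` along the motion the square root cancels, so the
second equation is polynomial. -/
theorem hasDerivAt_duffingOrbit {ψ : ℝ → ℝ} {t : ℝ}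
    (hψ : HasDerivAt ψ (duffingSpeed k A (ψ t)) t) :
    HasDerivAt (fun t => duffingOrbit k A (ψ t)) (duffingField k (duffingOrbit k A (ψ t))) t := by
  have hs := hψ.sin
  have hc := hψ.cos
  have hS : HasDerivAt (fun t => duffingSpeed k A (ψ t))
      (k / 2 * A ^ 2 * Real.sin (ψ t) * Real.cos (ψ t)) t := by
    have h := (((hs.pow 2).const_add 1).const_mul (k / 2 * A ^ 2)).const_add 1
    refine (h.sqrt (duffingSpeed_arg_pos hk hA (ψ t)).ne').congr_deriv ?_
    have hpos := duffingSpeed_pos hk hA (ψ t)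
    change _ / (2 * duffingSpeed k A (ψ t)) = _
    field_simp
    simp
    ring
  refine ((hs.const_mul A).prodMk ((hc.const_mul A).mul hS)).congr_deriv ?_
  have hsq := duffingSpeed_sq hk hA (ψ t)
  have hcs := Real.sin_sq_add_cos_sq (ψ t)
  refine Prod.ext ?_ ?_
  · simp [duffingField, duffingOrbit]
    ring
  · simp only [duffingField, duffingOrbit]
    linear_combination (-A * Real.sin (ψ t)) * hsq
      + k / 2 * A ^ 3 * Real.sin (ψ t) * hcs

omit hk hA in
theorem norm_duffingOrbit_le (hk : k < 0) (hA0 : 0 ≤ A) (φ : ℝ) : ‖duffingOrbit k A φ‖ ≤ A := by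
  refine max_le ?_ ?_
  · rw [duffingOrbit, Real.norm_eq_abs, abs_mul, abs_of_nonneg hA0]
    exact mul_le_of_le_one_right hA0 (Real.abs_sin_le_one φ)
  · rw [duffingOrbit, Real.norm_eq_abs, abs_mul, abs_mul, abs_of_nonneg hA0, mul_assoc]
    refine mul_le_of_le_one_right hA0 (mul_le_one₀ (Real.abs_cos_le_one φ) (abs_nonneg _) ?_)
    rw [abs_of_nonneg (show 0 ≤ duffingSpeed k A φ from Real.sqrt_nonneg _)]
    exact duffingSpeed_le_one hk φ

theorem duffingOrbit_ne_zero (hA0 : 0 < A) (φ : ℝ) : duffingOrbit k A φ ≠ 0 := by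
  intro h
  have h1 : A * Real.sin φ = 0 := congrArg Prod.fst h
  have h2 : A * Real.cos φ * duffingSpeed k A φ = 0 := congrArg Prod.snd h
  have hS := (duffingSpeed_pos hk hA φ).ne'
  have hs : Real.sin φ = 0 := by simpa [hA0.ne'] using h1
  have hc : Real.cos φ = 0 := by simpa [hA0.ne', hS] using h2
  have := Real.sin_sq_add_cos_sq φ
  simp [hs, hc] at this

omit hA in
/-- Every point of small energy lies on an orbit of small amplitude. -/
theorem exists_eq_duffingOrbit {δ : ℝ} (hδ : 0 < 1 + k * δ ^ 2) {p : ℝ × ℝ}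
    (hx : |p.1| < δ) (hE : p.2 ^ 2 + p.1 ^ 2 + k / 2 * p.1 ^ 4 < δ ^ 2 + k / 2 * δ ^ 4) :
    ∃ A φ, 0 ≤ A ∧ A < δ ∧ p = duffingOrbit k A φ := by
  obtain ⟨x, y⟩ := p
  simp only at hx hE
  have hcont : ContinuousOn (fun A : ℝ => A ^ 2 + k / 2 * A ^ 4) (Icc |x| δ) := by fun_prop
  have hx4 : |x| ^ 4 = x ^ 4 := by rw [show 4 = 2 * 2 by norm_num, pow_mul, sq_abs, ← pow_mul]
  have hmem : y ^ 2 + x ^ 2 + k / 2 * x ^ 4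
      ∈ Icc ((fun A : ℝ => A ^ 2 + k / 2 * A ^ 4) |x|) ((fun A : ℝ => A ^ 2 + k / 2 * A ^ 4) δ) := by
    refine ⟨?_, hE.le⟩
    simp only [sq_abs, hx4]
    linarith [sq_nonneg y]
  -- The amplitude is found by matching energies. Searching in `[|x|, δ]` ensures `|x| ≤ A`, so that
  -- `x / A` can be a sine.
  obtain ⟨A, ⟨hA1, hA2⟩, hAE⟩ := intermediate_value_Icc hx.le hcont hmem
  simp only at hAE
  have hA0 : 0 ≤ A := (abs_nonneg x).trans hA1
  have hAδ : A < δ := lt_of_le_of_ne hA2 fun h => by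
    rw [h] at hAE
    exact hE.ne' hAE
  have hA : 0 < 1 + k * A ^ 2 := by
    have : A ^ 2 ≤ δ ^ 2 := pow_le_pow_left₀ hA0 hA2 2
    nlinarith
  have hy2 : y ^ 2 = (A ^ 2 - x ^ 2) * (1 + k / 2 * (A ^ 2 + x ^ 2)) := by linarith
  rcases hA0.eq_or_lt with h0 | hApos
  · refine ⟨A, 0, hA0, hAδ, ?_⟩
    rw [← h0] at hA1 hy2
    have hx0 : x = 0 := abs_nonpos_iff.1 hA1
    have hy0 : y = 0 := by
      rw [hx0] at hy2
      exact pow_eq_zero_iff two_ne_zero |>.1 (by simpa using hy2)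
    simp [duffingOrbit, ← h0, hx0, hy0]
  · have hx2 : x ^ 2 ≤ A ^ 2 := by
      rw [← sq_abs x]
      exact pow_le_pow_left₀ (abs_nonneg x) hA1 2
    have hSpos : 0 < 1 + k / 2 * (A ^ 2 + x ^ 2) := by nlinarith
    set S := √(1 + k / 2 * (A ^ 2 + x ^ 2)) with hS
    have hSp : 0 < S := Real.sqrt_pos.2 hSpos
    have hS2 : S ^ 2 = 1 + k / 2 * (A ^ 2 + x ^ 2) := Real.sq_sqrt hSpos.le
    have hcirc : (y / (A * S)) ^ 2 + (x / A) ^ 2 = 1 := by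
      field_simp
      rw [hS2, hy2]
      ring
    -- The phase is the argument of this point of the unit circle.
    set z : ℂ := ⟨y / (A * S), x / A⟩ with hz
    have hz1 : ‖z‖ = 1 := by
      rw [Complex.norm_def, Complex.normSq_apply, Real.sqrt_eq_one, ← hcirc]
      simp only [hz]
      ring
    have hz0 : z ≠ 0 := norm_ne_zero_iff.1 (by rw [hz1]; exact one_ne_zero)
    have hsin : Real.sin z.arg = x / A := by rw [Complex.sin_arg, hz1, div_one]
    have hcos : Real.cos z.arg = y / (A * S) := by rw [Complex.cos_arg hz0, hz1, div_one]
    refine ⟨A, z.arg, hA0, hAδ, ?_⟩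
    have hspeed : duffingSpeed k A z.arg = S := by
      rw [duffingSpeed, hsin, hS]
      congr 1
      field_simp
    rw [duffingOrbit, hspeed, hsin, hcos]
    refine Prod.ext ?_ ?_
    · simp only
      field_simp
    · simp only
      field_simp

omit hA in
theorem isCentre_duffingField : IsCentre (duffingField k) 0 := by
  refine ⟨by simp [duffingField], fun W hW => ?_⟩
  obtain ⟨η, hη, hball⟩ := Metric.mem_nhds_iff.1 hW
  obtain ⟨δ, hδη, hδk, hδ0⟩ : ∃ δ : ℝ, δ < η ∧ 0 < 1 + k * δ ^ 2 ∧ 0 < δ := by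
    have h1 : ∀ᶠ δ : ℝ in 𝓝[>] 0, δ < η := nhdsWithin_le_nhds (gt_mem_nhds hη)
    have h2 : ∀ᶠ δ : ℝ in 𝓝[>] 0, 0 < 1 + k * δ ^ 2 := by
      refine nhdsWithin_le_nhds (ContinuousAt.eventually_lt (f := fun _ => (0 : ℝ))
        (g := fun δ => 1 + k * δ ^ 2) (by fun_prop) (by fun_prop) (by simp))
    exact (h1.and (h2.and self_mem_nhdsWithin)).exists
  refine ⟨{p | ∃ A φ, 0 ≤ A ∧ A < δ ∧ p = duffingOrbit k A φ}, ?_, ?_, ?_⟩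
  · have h1 : ∀ᶠ p : ℝ × ℝ in 𝓝 0, |p.1| < δ :=
      ContinuousAt.eventually_lt (by fun_prop) (by fun_prop) (by simpa using hδ0)
    have h2 : ∀ᶠ p : ℝ × ℝ in 𝓝 0,
        p.2 ^ 2 + p.1 ^ 2 + k / 2 * p.1 ^ 4 < δ ^ 2 + k / 2 * δ ^ 4 := by
      refine ContinuousAt.eventually_lt (by fun_prop) (by fun_prop) ?_
      have : 0 < δ ^ 2 * (1 + k / 2 * δ ^ 2) := mul_pos (by positivity) (by nlinarith)
      simp only [Prod.fst_zero, Prod.snd_zero]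
      nlinarith
    filter_upwards [h1, h2] with p hp1 hp2
    exact exists_eq_duffingOrbit hk hδk hp1 hp2
  · rintro p ⟨A, φ, hA0, hAδ, rfl⟩
    refine hball ?_
    rw [mem_ball_zero_iff]
    exact (norm_duffingOrbit_le hk hA0 φ).trans_lt (hAδ.trans hδη)
  · rintro q ⟨A, φ₀, hA0, hAδ, rfl⟩ hq
    have hApos : 0 < A := lt_of_le_of_ne hA0 fun h => hq <| by
      rw [← h]
      simp [duffingOrbit]
    have hA : 0 < 1 + k * A ^ 2 := by
      have : A ^ 2 ≤ δ ^ 2 := pow_le_pow_left₀ hA0 hAδ.le 2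
      nlinarith
    have hper : Function.Periodic (duffingSpeed k A) (2 * Real.pi) := fun φ => by
      simp only [duffingSpeed, Real.sin_add_two_pi]
    obtain ⟨ψ, T, hT, hψ0, hψ, hψT, hsurj⟩ := exists_rotating_solution
      (S := duffingSpeed k A) (by unfold duffingSpeed; fun_prop) (duffingSpeed_pos hk hA)
      (duffingSpeed_le_one hk) Real.two_pi_pos hper φ₀
    refine ⟨fun t => duffingOrbit k A (ψ t), T, hT, by simp only [hψ0],
      fun t => hasDerivAt_duffingOrbit hk hA (hψ t), fun t => ?_, ?_, fun t => ⟨?_, ?_⟩⟩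
    · simp only [hψT, duffingOrbit, hper (ψ t), Real.sin_add_two_pi, Real.cos_add_two_pi]
    -- The phase takes all real values, so the orbit visits the abscissas `A` and `-A`.
    · by_contra! hconst
      obtain ⟨t₁, ht₁⟩ := hsurj (Real.pi / 2)
      obtain ⟨t₂, ht₂⟩ := hsurj (-(Real.pi / 2))
      have h := congrArg Prod.fst ((hconst t₁).trans (hconst t₂).symm)
      simp only [duffingOrbit, ht₁, ht₂, Real.sin_neg, Real.sin_pi_div_two] at h
      linarith
    · exact ⟨A, ψ t, hA0, hAδ, rfl⟩
    · exact duffingOrbit_ne_zero hk hA hApos _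

end Duffing

/-! ### Eliminating coefficients by the vanishing conditions, and the theorem. -/

theorem canonicalField_eq_perturbedRotation {a b ε : ℝ} {d : RLCoeffs} (h₃ : d.d₃ = 0) :
    canonicalField a b ε d = perturbedRotation (nonlinearForms (2 * b / a ^ 2)
      (ε * d.d₁) (ε * d.d₂) (ε * d.d₄) (ε * d.d₅) (ε * d.d₆)) := by
  funext p
  refine Prod.ext rfl ?_
  simp only [canonicalField, perturbedRotation, nonlinearForms_zero, nonlinearForms_one,
    nonlinearForms_two, h₃]
  ring

section VanishingConditions

variable {k e₁ e₂ e₄ e₅ e₆ : ℝ} {V : ℕ → ℝ}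
  (hV : V = lyapunovConstant (perturbedRotation (nonlinearForms k e₁ e₂ e₄ e₅ e₆)))
include hV

theorem lyapunov_three_eq : V 3 = -(Real.pi / 4) * (e₂ + 3 * e₄) := by
  rw [hV, lyapunovConstant_three]

theorem eq_of_lyapunov_three (h3 : V 3 = 0) : e₂ = -3 * e₄ := by
  rw [lyapunov_three_eq hV, neg_mul, neg_eq_zero, mul_eq_zero] at h3
  have := h3.resolve_left (by positivity)
  linarith

theorem lyapunov_five_eq (h3 : V 3 = 0) :
    V 5 = -(Real.pi / 8) * (e₁ + 5 * e₆ + 3 * k * e₄) := by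
  obtain rfl := eq_of_lyapunov_three hV h3
  rw [hV, lyapunovConstant_five]

theorem eq_of_lyapunov_five (h3 : V 3 = 0) (h5 : V 5 = 0) : e₁ = -5 * e₆ - 3 * k * e₄ := by
  rw [lyapunov_five_eq hV h3, neg_mul, neg_eq_zero, mul_eq_zero] at h5
  have := h5.resolve_left (by positivity)
  linarith

theorem lyapunov_seven_eq (h3 : V 3 = 0) (h5 : V 5 = 0) :
    V 7 = -(Real.pi / 64) * (-6 * e₄ ^ 3 + 5 * e₅ + 40 * k * e₆) := by
  obtain rfl := eq_of_lyapunov_three hV h3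
  obtain rfl := eq_of_lyapunov_five hV h3 h5
  rw [hV, lyapunovConstant_seven]

theorem eq_of_lyapunov_seven (h3 : V 3 = 0) (h5 : V 5 = 0) (h7 : V 7 = 0) :
    e₅ = 6 / 5 * e₄ ^ 3 - 8 * k * e₆ := by
  rw [lyapunov_seven_eq hV h3 h5, neg_mul, neg_eq_zero, mul_eq_zero] at h7
  have := h7.resolve_left (by positivity)
  linarith

theorem lyapunov_nine_eq (h3 : V 3 = 0) (h5 : V 5 = 0) (h7 : V 7 = 0) :
    V 9 = Real.pi * (9 / 32 * e₄ ^ 2 * e₆ + 9 / 80 * k * e₄ ^ 3 - 21 / 128 * k ^ 2 * e₆) := by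
  obtain rfl := eq_of_lyapunov_three hV h3
  obtain rfl := eq_of_lyapunov_five hV h3 h5
  obtain rfl := eq_of_lyapunov_seven hV h3 h5 h7
  rw [hV, lyapunovConstant_nine]

theorem eq_of_lyapunov_nine (h3 : V 3 = 0) (h5 : V 5 = 0) (h7 : V 7 = 0) (h9 : V 9 = 0) :
    9 / 32 * e₄ ^ 2 * e₆ + 9 / 80 * k * e₄ ^ 3 - 21 / 128 * k ^ 2 * e₆ = 0 := by
  rw [lyapunov_nine_eq hV h3 h5 h7, mul_eq_zero] at h9
  exact h9.resolve_left Real.pi_ne_zero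

theorem lyapunov_eleven_eq (hk : k ≠ 0) (h3 : V 3 = 0) (h5 : V 5 = 0) (h7 : V 7 = 0)
    (h9 : V 9 = 0) :
    12 * e₄ ^ 2 - 7 * k ^ 2 ≠ 0 ∧
    V 11 = -(3 * Real.pi * e₄ ^ 3 / (12800 * (12 * e₄ ^ 2 - 7 * k ^ 2) ^ 2)) *
      (20160 * e₄ ^ 6 + 42304 * k ^ 2 * e₄ ^ 4 - 36260 * k ^ 4 * e₄ ^ 2 - 7350 * k ^ 6) := by
  have hrel := eq_of_lyapunov_nine hV h3 h5 h7 h9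
  obtain rfl := eq_of_lyapunov_three hV h3
  obtain rfl := eq_of_lyapunov_five hV h3 h5
  obtain rfl := eq_of_lyapunov_seven hV h3 h5 h7
  -- This is, up to a constant, the coefficient of `e₆` in `V 9 = 0`. Were it zero, the relation
  -- would leave `k e₄³ = 0`, hence `e₄ = 0` and then `k = 0`.
  have hD : 12 * e₄ ^ 2 - 7 * k ^ 2 ≠ 0 := by
    intro h
    have h0 : k * e₄ ^ 3 = 0 := by linear_combination 80 / 9 * hrel - 5 / 24 * e₆ * h
    have he : e₄ = 0 := by simpa [hk] using h0
    simp [he, hk] at h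
  refine ⟨hD, ?_⟩
  have he : e₆ = -(24 / 5 * k * e₄ ^ 3) / (12 * e₄ ^ 2 - 7 * k ^ 2) := by
    rw [eq_div_iff hD]
    linear_combination 128 / 3 * hrel
  rw [hV, lyapunovConstant_eleven k e₄ e₆ hrel, he]
  generalize hDe : 12 * e₄ ^ 2 - 7 * k ^ 2 = D at hD ⊢
  field_simp
  rw [← hDe]
  ring

end VanishingConditions

theorem mainTheorem6 (a b : ℝ) (ha : 0 < a) (hb : b < 0) :
    (∀ (ε : ℝ) (d : RLCoeffs), d.d₃ = 0 →
      ∀ (F : ℝ × ℝ → ℝ × ℝ) (V : ℕ → ℝ), F = canonicalField a b ε d → V = lyapunovConstant F →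
      PolarWellPosed F ∧ AnalyticAt ℝ (returnMap F) 0 ∧
      V 1 = 1 ∧
      V 3 = -(1 / 4) * Real.pi * ε * (d.d₂ + 3 * d.d₄) ∧
      (V 3 = 0 →
        V 5 = -(Real.pi * ε * (a ^ 2 * d.d₁ + 5 * a ^ 2 * d.d₆ + 6 * b * d.d₄)) / (8 * a ^ 2)) ∧
      (V 3 = 0 → V 5 = 0 →
        V 7 = -(Real.pi * ε * (-6 * a ^ 2 * d.d₄ ^ 3 * ε ^ 2 + 5 * a ^ 2 * d.d₅ + 80 * b * d.d₆))
          / (64 * a ^ 2)) ∧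
      (V 3 = 0 → V 5 = 0 → V 7 = 0 →
        V 9 = 3 * Real.pi * ε * (15 * a ^ 4 * d.d₄ ^ 2 * d.d₆ * ε ^ 2
            + 12 * a ^ 2 * b * d.d₄ ^ 3 * ε ^ 2 - 35 * b ^ 2 * d.d₆) / (160 * a ^ 4)) ∧
      (V 3 = 0 → V 5 = 0 → V 7 = 0 → V 9 = 0 →
        3 * a ^ 4 * d.d₄ ^ 2 * ε ^ 2 - 7 * b ^ 2 ≠ 0 ∧
        V 11 = -(3 * Real.pi * d.d₄ ^ 3 * ε ^ 3
            / (3200 * a ^ 4 * (3 * a ^ 4 * d.d₄ ^ 2 * ε ^ 2 - 7 * b ^ 2) ^ 2))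
          * (315 * a ^ 12 * d.d₄ ^ 6 * ε ^ 6 + 2644 * a ^ 8 * b ^ 2 * d.d₄ ^ 4 * ε ^ 4
            - 9065 * a ^ 4 * b ^ 4 * d.d₄ ^ 2 * ε ^ 2 - 7350 * b ^ 6)) ∧
      (ε ≠ 0 → V 3 = 0 → V 5 = 0 → V 7 = 0 → V 9 = 0 → d.d₄ = 0 →
        (d.d₁ = 0 ∧ d.d₂ = 0 ∧ d.d₅ = 0 ∧ d.d₆ = 0) ∧
        IsHamiltonianField F ∧ IsCentre F 0)) ∧
    (∀ M : ℝ, ∃ ε₀ : ℝ, 0 < ε₀ ∧ ∀ (ε : ℝ) (d : RLCoeffs),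
      0 < |ε| → |ε| < ε₀ → d.d₃ = 0 → |d.d₄| ≤ M →
      ∀ V : ℕ → ℝ, V = lyapunovConstant (canonicalField a b ε d) →
      V 3 = 0 → V 5 = 0 → V 7 = 0 → V 9 = 0 → (V 11 = 0 ↔ d.d₄ = 0)) := by
  have ha' : a ≠ 0 := ha.ne'
  have hk : 2 * b / a ^ 2 < 0 := div_neg_of_neg_of_pos (by linarith) (by positivity)
  constructor
  · intro ε d h₃ F V hF hV
    have hF' := hF.trans (canonicalField_eq_perturbedRotation h₃)
    have hV' := hV
    rw [hF'] at hV'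
    have hhom := isHomogeneousOfDegree_nonlinearForms (2 * b / a ^ 2) (ε * d.d₁) (ε * d.d₂)
      (ε * d.d₄) (ε * d.d₅) (ε * d.d₆)
    refine ⟨?_, ?_, ?_, ?_, fun h3 => ?_, fun h3 h5 => ?_, fun h3 h5 h7 => ?_,
      fun h3 h5 h7 h9 => ?_, fun hε h3 h5 h7 h9 h4 => ?_⟩
    · rw [hF']
      exact polarWellPosed_perturbedRotation hhom
    · rw [hF']
      exact analyticAt_returnMap_perturbedRotation hhom
    · rw [hV']
      exact lyapunovConstant_one_perturbedRotation hhom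
    · rw [lyapunov_three_eq hV']
      ring
    · rw [lyapunov_five_eq hV' h3]
      field_simp
      ring
    · rw [lyapunov_seven_eq hV' h3 h5]
      field_simp
      ring
    · rw [lyapunov_nine_eq hV' h3 h5 h7]
      field_simp
      ring
    · obtain ⟨hD, h11⟩ := lyapunov_eleven_eq hV' hk.ne h3 h5 h7 h9
      have hDe : 12 * (ε * d.d₄) ^ 2 - 7 * (2 * b / a ^ 2) ^ 2
          = 4 / a ^ 4 * (3 * a ^ 4 * d.d₄ ^ 2 * ε ^ 2 - 7 * b ^ 2) := by
        field_simp
        ring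
      have hD' : 3 * a ^ 4 * d.d₄ ^ 2 * ε ^ 2 - 7 * b ^ 2 ≠ 0 := by
        intro h
        exact hD (by rw [hDe, h, mul_zero])
      refine ⟨hD', ?_⟩
      rw [h11, hDe]
      field_simp
      ring
    · have hrel := eq_of_lyapunov_nine hV' h3 h5 h7 h9
      have h2 := eq_of_lyapunov_three hV' h3
      have h1 := eq_of_lyapunov_five hV' h3 h5
      have h5' := eq_of_lyapunov_seven hV' h3 h5 h7
      -- With `e₄ = 0` the ninth condition is `k² e₆ = 0`; the earlier ones then annihilate the
      -- other coefficients.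
      have hd₆ : d.d₆ = 0 := by simpa [h4, hε, hb.ne, ha'] using hrel
      have hd₁ : d.d₁ = 0 := by simpa [h4, hε, hd₆] using h1
      have hd₂ : d.d₂ = 0 := by simpa [h4, hε] using h2
      have hd₅ : d.d₅ = 0 := by simpa [h4, hε, hd₆] using h5'
      have hduff : F = duffingField (2 * b / a ^ 2) := by
        rw [hF]
        funext p
        simp [canonicalField, duffingField, h₃, h4, hd₁, hd₂, hd₅, hd₆]
      rw [hduff]
      exact ⟨⟨hd₁, hd₂, hd₅, hd₆⟩, isHamiltonianField_duffingField _, isCentre_duffingField hk⟩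
  · intro M
    -- Chosen so that `2 |ε d₄| ≤ |k|`, where `|k| = -2b/a²`; `|M| + 1` keeps the denominator
    -- positive for every `M`.
    refine ⟨-b / (a ^ 2 * (|M| + 1)), div_pos (by linarith) (by positivity), ?_⟩
    intro ε d hε hε₀ h₃ hM V hV h3 h5 h7 h9
    rw [canonicalField_eq_perturbedRotation h₃] at hV
    obtain ⟨hD, h11⟩ := lyapunov_eleven_eq hV hk.ne h3 h5 h7 h9
    set k := 2 * b / a ^ 2 with hkdef
    have hε' : ε ≠ 0 := abs_pos.1 hε
    have hsmall : (2 * (ε * d.d₄)) ^ 2 ≤ k ^ 2 := by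
      rw [← sq_abs, ← sq_abs k]
      refine pow_le_pow_left₀ (abs_nonneg _) ?_ 2
      rw [lt_div_iff₀ (by positivity)] at hε₀
      have h1 : |ε * d.d₄| ≤ |ε| * (|M| + 1) := by
        rw [abs_mul]
        exact mul_le_mul_of_nonneg_left (by linarith [le_abs_self M]) (abs_nonneg _)
      have h2 : |ε| * (|M| + 1) ≤ -b / a ^ 2 := by
        rw [le_div_iff₀ (by positivity)]
        linarith
      have habs : |k| = 2 * (-b / a ^ 2) := by
        rw [abs_of_neg hk, hkdef]
        ring
      rw [habs, abs_mul, abs_two]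
      linarith
    have hneg : 20160 * (ε * d.d₄) ^ 6 + 42304 * k ^ 2 * (ε * d.d₄) ^ 4
        - 36260 * k ^ 4 * (ε * d.d₄) ^ 2 - 7350 * k ^ 6 < 0 := by
      obtain ⟨X, hX⟩ : ∃ X, X = (ε * d.d₄) ^ 2 := ⟨_, rfl⟩
      obtain ⟨Y, hY⟩ : ∃ Y, Y = k ^ 2 := ⟨_, rfl⟩
      have hX0 : 0 ≤ X := hX ▸ sq_nonneg _
      have hY0 : 0 < Y := hY ▸ sq_pos_of_neg hk
      -- With `4 X ≤ Y` the two positive terms are at most `(1260 + 10576) X Y²`, which `36260 X Y²`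
      -- outweighs; `-7350 Y³` makes the inequality strict.
      have hXY : 4 * X ≤ Y := by
        rw [hX, hY]
        linarith
      have h1 : X ^ 2 ≤ X * Y / 4 := by nlinarith
      have h2 : X ^ 2 * X ≤ X * Y / 4 * X := mul_le_mul_of_nonneg_right h1 hX0
      have h3 : X * X * Y ≤ X * Y ^ 2 / 4 := by nlinarith
      have h4 : 0 < Y ^ 3 := by positivity
      have h5 : 0 ≤ X * Y ^ 2 := by positivity
      have : 20160 * X ^ 3 + 42304 * Y * X ^ 2 - 36260 * Y ^ 2 * X - 7350 * Y ^ 3 < 0 := by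
        nlinarith
      rw [hX, hY] at this
      linarith
    have hcoef : 12800 * (12 * (ε * d.d₄) ^ 2 - 7 * k ^ 2) ^ 2 ≠ 0 :=
      mul_ne_zero (by norm_num) (pow_ne_zero 2 hD)
    constructor
    · intro h0
      rw [h11, mul_eq_zero, or_iff_left hneg.ne, neg_eq_zero, div_eq_zero_iff,
        or_iff_left hcoef] at h0
      simpa [Real.pi_ne_zero, hε'] using h0
    · intro h4
      rw [h11, h4]
      simp
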